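/- **Setting.** Consider finite directed multigraphs whose edges have types $I,L,R$. A planar rooted binary forest (PRBF) is such a graph in which every vertex has at most one incoming edge and at most one outgoing edge of each type, the source of an $I$-edge has no other incident edge that leaves or enters it, there is no directed cycle, the source of an $L$-edge (resp. $R$-edge) is also the source of an $R$-edge (resp. $L$-edge), and the source of any $L$- or $R$-edge has an incoming edge. A planar rooted binary tree (PRBT) is a connected PRBF with at least one edge; $|$ denotes the tree consisting of a single $I$-edge. Let $\hat{\mathbf C}$ be the real vector space with basis $|X\rangle$ indexed by isomorphism classes of graphs, and let $\langle|$ be the linear form with $\langle|X\rangle=1$. A rule $r=(O\leftarrow K\to I,\mathsf c)$ acts by $\rho(r)|X\rangle=\sum_m|r_m(X)\rangle$, summed over the injective matches $m$ of $I$ in $X$ satisfying $\mathsf c$, where $r_m(X)$ is the result of sesqui-pushout rewriting. The Rémy generator is $\hat G=\hat G_L+\hat G_R$, where $\hat G_L$ (resp. $\hat G_R$) is the sum over $T\in\{I,L,R\}$ of the rules (applied to PRBFs) replacing a $T$-edge $u\to w$ by a $T$-edge $u\to y$ to a new vertex $y$ with a new left (resp. right) leaf, $w$ becoming the other child of $y$.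 Fix a side $s\in\{L,R\}$. For $k\ge 0$ let the $k$-comb pattern with first edge type $T$ be a directed path with $k+1$ edges, the first of type $T$ and all others of type $s$, together with an edge of the opposite type to a further vertex at each of the $k$ inner vertices of the path. Let $\hat O_E,\hat O_{P1},\hat O_{P2},\hat O_{P3}$ be the observables counting $k$-combs for $k=0,1,2,3$ (sum over $T\in\{I,L,R\}$ of the representations of the identity rules on the pattern); thus $\hat O_i|X\rangle=N_i(X)|X\rangle$ with $N_i(X)$ the number of occurrences. For $0\le j\le k$ and a side $c$ let $\hat R_{k,j,c}$ be the sum over $T$ of the rules (applied to PRBFs) inserting, as above, a leaf on side $c$ at edge number $j$ (counted from $0$) of the path of a $k$-comb. Put $\hat R_{P3'}:=\hat R_{3,1,s}$, and let $\bar s$ be the side opposite to $s$. **(1) Commutators.** On the span of the PRBTs, $$[\hat O_E,\hat G]=2\hat G,\quad \langle|\hat G=2\langle|\hat O_E,\quad [\hat O_{P1},\hat G]=\hat G,$$ $$[\hat O_{P2},\hat G]=\hat R_{1,0,\bar s}+\hat R_{1,1,s}+\hat R_{1,1,\bar s}-\hat R_{2,1,s}-\hat R_{2,1,\bar s},$$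 $$[\hat O_{P3},\hat G]=\hat R_{2,0,\bar s}+\hat R_{2,1,\bar s}+\hat R_{2,2,s}+\hat R_{2,2,\bar s}-\hat R_{3,1,\bar s}-\hat R_{3,2,s}-\hat R_{3,2,\bar s}-\hat R_{P3'},$$ $$[\hat O_{P2},[\hat O_{P2},\hat G]]=[\hat O_{P2},\hat G],\quad [\hat O_{P2},[\hat O_{P3},\hat G]]=[\hat O_{P3},\hat G]+\hat R_{P3'},\quad [\hat O_{P3},[\hat O_{P3},\hat G]]=[\hat O_{P3},\hat G]+2\hat R_{P3'},$$ $$[\hat O_{P2},\hat R_{P3'}]=0,\quad [\hat O_{P3},\hat R_{P3'}]=-\hat R_{P3'},$$ $$\langle|[\hat O_{P2},\hat G]=\langle|(3\hat O_{P1}-2\hat O_{P2}),\quad \langle|[\hat O_{P3},\hat G]=\langle|(4\hat O_{P2}-4\hat O_{P3}),\quad \langle|\hat R_{P3'}=\langle|\hat O_{P3}.$$ **(2) Polynomial jump-closure.** For every integer $q\ge 0$ there are $N(q)\in\mathbb Z_{\ge0}^4$ and reals $\gamma_q(\vec\omega,\vec k)$ such that for all $\vec\omega\in\mathbb R^4$,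 on the span of the PRBTs, $\langle|\,\mathrm{ad}^{\circ q}_{\vec\omega\cdot\vec O}(\hat G)=\sum_{\vec 0\le\vec k\le N(q)}\gamma_q(\vec\omega,\vec k)\,\langle|\vec O^{\vec k}$. **(3) Evolution equation.** For $\vec\omega=(\varepsilon,\gamma,\mu,\nu)\in\mathbb R^4$ let $\mathcal G(\lambda;\vec\omega)=\langle|e^{\vec\omega\cdot\vec O}e^{\lambda\hat G}|\,|\,\rangle$, a formal power series in $\lambda$. Its coefficients are given by convergent exponential series in $\vec\omega\cdot\vec O$ and are smooth functions of $\vec\omega$, and, coefficientwise in $\lambda$, $$\partial_\lambda\mathcal G=e^{2\varepsilon+\gamma}\Big(2\partial_\varepsilon+3(e^\mu-1)\partial_\gamma+(4e^{\mu+\nu}-6e^\mu+2)\partial_\mu+(3e^\mu+e^{-\nu}-3e^{\mu+\nu}-1)\partial_\nu\Big)\mathcal G .$$ **(4) Markov chain on pattern counts.** Substituting $\omega_i=\ln x_i$ ($x_i>0$), the coefficients of $\mathcal G$ become polynomials in $x=(x_\varepsilon,x_\gamma,x_\mu,x_\nu)$, and $\partial_\lambda\mathcal G=\hat{\mathsf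 D}\mathcal G$ where, with $\hat n_i=x_i\partial_{x_i}$, $$\hat{\mathsf D}=x_\varepsilon^2x_\gamma\Big((2\hat n_\varepsilon-3\hat n_\gamma+2\hat n_\mu-\hat n_\nu)+x_\mu(3\hat n_\gamma-6\hat n_\mu+3\hat n_\nu)+x_\mu x_\nu(4\hat n_\mu-3\hat n_\nu)+x_\nu^{-1}\hat n_\nu\Big).$$ The coefficients of $\hat{\mathsf D}$ sum to $2\hat n_\varepsilon$ (i.e. $\hat{\mathsf D}p$ and $2\hat n_\varepsilon p$ agree at $x=(1,1,1,1)$ for every polynomial $p$). Let $\hat{\mathsf d}=\hat{\mathsf D}(2\hat n_\varepsilon)_*^{-1}$, where $(2\hat n_\varepsilon)^{-1}_*$ divides the monomial $x^N$ by $2N_\varepsilon$ (and fixes it if $N_\varepsilon=0$). Then $\hat{\mathsf d}$ is the generator of a discrete-time Markov chain on the set $S$ of pattern counts $N(X)$ of PRBTs $X$: every $N\in S$ has $N_\varepsilon>0$, and the coefficients of $\hat{\mathsf d}\,x^N$ are non-negative, sum to $1$, and vanish outside the monomials $x^M$ with $M\in S$. It describes the pattern counts of the embedded chain $\hat d=\hat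 G\cdot(\hat{\mathbb O}(G))_*^{-1}$ of $\hat G$, where $\hat{\mathbb O}(G)$ is the observable counting the matches of the rules of $\hat G$ and $(\hat{\mathbb O}(G))_*^{-1}|X\rangle$ is $|X\rangle$ divided by the number of these matches (and $|X\rangle$ if $\hat G|X\rangle=0$). That is, for every PRBT $X$, $\hat d|X\rangle$ is a probability distribution on PRBTs with $\langle|x^{\vec O}\hat d|X\rangle=\hat{\mathsf d}\,x^{N(X)}$, and $P(\tau;x)=\langle|x^{\vec O}e^{\tau\hat d}|\,|\,\rangle$ satisfies $\partial_\tau P=\hat{\mathsf d}P$ as a formal power series in $\tau$. -/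

import Mathlib

open scoped Nat

noncomputable section

namespace PRBT

/-! ### Typed graphs and planar rooted binary trees -/

/-- Left or right. -/
inductive Side | L | R
  deriving DecidableEq

/-- The opposite side. -/
def Side.opp : Side → Side
  | .L => .R
  | .R => .L

/-- The edge types `I` (root edge), `L` and `R` (edges to left and right children). -/
inductive EdgeType | I | of (c : Side)
  deriving DecidableEq

instance sideFintype : Fintype Side := ⟨{.L, .R}, fun c => by cases c <;> simp⟩

instance edgeTypeFintype : Fintype EdgeType :=
  ⟨{.I, .of .L, .of .R}, fun T => by rcases T with _ | _ | _ <;> simp⟩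

/-- Finite directed multigraphs with edges typed by `I`, `L`, `R`. -/
structure TGraph where
  V : Type
  E : Type
  finV : Finite V
  finE : Finite E
  src : E → V
  tgt : E → V
  typ : E → EdgeType

attribute [instance] TGraph.finV TGraph.finE

/-- Morphisms of typed graphs. -/
@[ext]
structure Hom (X Y : TGraph) where
  fV : X.V → Y.V
  fE : X.E → Y.E
  src_comm : ∀ e, Y.src (fE e) = fV (X.src e)
  tgt_comm : ∀ e, Y.tgt (fE e) = fV (X.tgt e)
  typ_comm : ∀ e, Y.typ (fE e) = X.typ e

/-- Monomorphisms. -/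
def Hom.IsMono {X Y : TGraph} (f : Hom X Y) : Prop :=
  Function.Injective f.fV ∧ Function.Injective f.fE

/-- Isomorphism of typed graphs. -/
def Iso (X Y : TGraph) : Prop :=
  ∃ f : Hom X Y, Function.Bijective f.fV ∧ Function.Bijective f.fE

theorem Iso.refl (X : TGraph) : Iso X X :=
  ⟨⟨id, id, fun _ => rfl, fun _ => rfl, fun _ => rfl⟩, Function.bijective_id, Function.bijective_id⟩

theorem Iso.symm {X Y : TGraph} (h : Iso X Y) : Iso Y X := by
  obtain ⟨f, hV, hE⟩ := h
  let v := Equiv.ofBijective _ hV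
  let e := Equiv.ofBijective _ hE
  have he : ∀ x, f.fE (e.symm x) = x := fun x => e.apply_symm_apply x
  refine ⟨⟨v.symm, e.symm, fun x => ?_, fun x => ?_, fun x => ?_⟩, v.symm.bijective,
    e.symm.bijective⟩
  · rw [eq_comm, Equiv.symm_apply_eq]
    exact (congrArg Y.src (he x)).symm.trans (f.src_comm _)
  · rw [eq_comm, Equiv.symm_apply_eq]
    exact (congrArg Y.tgt (he x)).symm.trans (f.tgt_comm _)
  · exact (f.typ_comm _).symm.trans (congrArg Y.typ (he x))

theorem Iso.trans {X Y Z : TGraph} (h : Iso X Y) (k : Iso Y Z) : Iso X Z := by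
  obtain ⟨f, hV, hE⟩ := h
  obtain ⟨g, kV, kE⟩ := k
  exact ⟨⟨g.fV ∘ f.fV, g.fE ∘ f.fE,
    fun e => (g.src_comm _).trans (congrArg g.fV (f.src_comm e)),
    fun e => (g.tgt_comm _).trans (congrArg g.fV (f.tgt_comm e)),
    fun e => (g.typ_comm _).trans (f.typ_comm e)⟩, kV.comp hV, kE.comp hE⟩

instance isoSetoid : Setoid TGraph where
  r := Iso
  iseqv := ⟨Iso.refl, Iso.symm, Iso.trans⟩

/-- Isomorphism classes of typed graphs. -/
def IsoClass : Type 1 := Quotient isoSetoid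

/-- There is an edge from `u` to `v`. -/
def TGraph.Step (X : TGraph) (u v : X.V) : Prop := ∃ e, X.src e = u ∧ X.tgt e = v

/-- Planar rooted binary forests: the first five fields are the negative constraints (forbidden
subgraphs), the last two the positive ones. -/
structure IsPRBF (X : TGraph) : Prop where
  in_unique : ∀ e e', X.tgt e = X.tgt e' → e = e'
  out_unique : ∀ e e', X.src e = X.src e' → X.typ e = X.typ e' → e = e'
  root_out : ∀ e e', X.typ e = .I → X.src e' = X.src e → e' = e
  root_in : ∀ e e', X.typ e = .I → X.tgt e' ≠ X.src e
  acyclic : ∀ v, ¬ Relation.TransGen X.Step v v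
  sibling : ∀ e c, X.typ e = .of c → ∃ e', X.src e' = X.src e ∧ X.typ e' = .of c.opp
  parent : ∀ e c, X.typ e = .of c → ∃ e', X.tgt e' = X.src e

/-- Planar rooted binary trees: connected forests with at least one edge. The root is the source
of the unique `I`-edge; inner nodes have one `L`- and one `R`-edge to their children. -/
structure IsPRBT (X : TGraph) : Prop where
  forest : IsPRBF X
  nonempty : Nonempty X.E
  connected : ∀ u v, Relation.EqvGen X.Step u v

/-! ### Sesqui-pushout rewriting and the canonical representation -/

/-- Linear rules `O ← K → I` with an application condition on matches of `I`. -/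
structure Rule where
  O : TGraph
  K : TGraph
  I : TGraph
  o : Hom K O
  i : Hom K I
  o_mono : o.IsMono
  i_mono : i.IsMono
  cond : (X : TGraph) → Hom I X → Prop

/-- Admissible matches of a rule. -/
def Match (r : Rule) (X : TGraph) : Type :=
  {m : Hom r.I X // m.IsMono ∧ r.cond X m}

instance homFinite (X Y : TGraph) : Finite (Hom X Y) :=
  Finite.of_injective (fun f : Hom X Y => (f.fV, f.fE)) fun _ _ h =>
    Hom.ext (congrArg Prod.fst h) (congrArg Prod.snd h)

instance matchFinite (r : Rule) (X : TGraph) : Finite (Match r X) :=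
  inferInstanceAs (Finite {m : Hom r.I X // m.IsMono ∧ r.cond X m})

instance matchFintype (r : Rule) (X : TGraph) : Fintype (Match r X) := Fintype.ofFinite _

section Rewrite

variable {r : Rule} {X : TGraph} (m : Match r X)

/-- The vertex `v` is not deleted by the rule. -/
def KeepV (v : X.V) : Prop := ∀ a, m.1.fV a = v → a ∈ Set.range r.i.fV

/-- The edge `e` is neither deleted by the rule nor incident to a deleted vertex. -/
def KeepE (e : X.E) : Prop :=
  (∀ a, m.1.fE a = e → a ∈ Set.range r.i.fE) ∧ KeepV m (X.src e) ∧ KeepV m (X.tgt e)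

/-- Vertices after rewriting: kept vertices and vertices created by the rule. -/
def NewV : Type := {v : X.V // KeepV m v} ⊕ {v : r.O.V // v ∉ Set.range r.o.fV}

/-- Edges after rewriting: kept edges and edges created by the rule. -/
def NewE : Type := {e : X.E // KeepE m e} ⊕ {e : r.O.E // e ∉ Set.range r.o.fE}

instance newVFinite : Finite (NewV m) := inferInstanceAs (Finite (_ ⊕ _))

instance newEFinite : Finite (NewE m) := inferInstanceAs (Finite (_ ⊕ _))

theorem keepV_image (k : r.K.V) : KeepV m (m.1.fV (r.i.fV k)) :=
  fun _ ha => ⟨k, (m.2.1.1 ha).symm⟩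

open Classical in
/-- The comatch `O → Y` on vertices. -/
def comatchV (v : r.O.V) : NewV m :=
  if h : v ∈ Set.range r.o.fV then .inl ⟨_, keepV_image m h.choose⟩ else .inr ⟨v, h⟩

/-- The result of rewriting `X` with the rule `r` at the match `m`: the final pullback complement
of `K → I → X` (delete the image of `I ∖ K` and all edges incident to deleted vertices), followed
by the pushout along `K → O` (add `O ∖ K`). -/
def rewrite : TGraph where
  V := NewV m
  E := NewE m
  finV := inferInstance
  finE := inferInstance
  src := Sum.elim (fun e => .inl ⟨X.src e.1, e.2.2.1⟩) (fun e => comatchV m (r.O.src e.1))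
  tgt := Sum.elim (fun e => .inl ⟨X.tgt e.1, e.2.2.2⟩) (fun e => comatchV m (r.O.tgt e.1))
  typ := Sum.elim (fun e => X.typ e.1) (fun e => r.O.typ e.1)

end Rewrite

/-- The real vector space with basis the isomorphism classes of typed graphs. -/
abbrev Chat : Type 1 := IsoClass →₀ ℝ

/-- Linear operators on `Chat`, with commutator bracket `⁅A, B⁆ = A * B - B * A`. -/
abbrev Op : Type 1 := Module.End ℝ Chat

/-- The basis vector `|X⟩`. -/
def ket (X : TGraph) : Chat := Finsupp.single (Quotient.mk isoSetoid X) 1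

/-- The dual vector `⟨|`, with `⟨|X⟩ = 1` for every `X`. -/
def bra : Chat →ₗ[ℝ] ℝ := Finsupp.linearCombination ℝ fun _ => (1 : ℝ)

/-- The canonical representation: `ρ(r)|X⟩ = ∑ₘ |rₘ(X)⟩` over all matches `m` of `r` in `X`
(computed in any representative `X` of the isomorphism class). -/
def rho (r : Rule) : Op :=
  Finsupp.linearCombination ℝ fun c : IsoClass =>
    ∑ m : Match r (Quotient.out c), ket (rewrite m)

/-! ### Patterns, observables and insertion rules -/

/-- The comb with `n` inner nodes: a directed path `0 → 1 → ⋯ → n + 1`, whose first edge has type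
`T` and whose other edges have type `s`, where moreover each inner node `1, …, n` of the path has
an edge of the opposite type to a further vertex. -/
def comb (n : ℕ) (T : EdgeType) (s : Side) : TGraph where
  V := Fin (n + 2) ⊕ Fin n
  E := Fin (n + 1) ⊕ Fin n
  finV := inferInstance
  finE := inferInstance
  src := Sum.elim (fun j => .inl j.castSucc) (fun j => .inl j.succ.castSucc)
  tgt := Sum.elim (fun j => .inl j.succ) (fun j => .inr j)
  typ := Sum.elim (fun j => if j = 0 then T else .of s) (fun _ => .of s.opp)

/-- The tree `|` that consists of a single root edge. -/
def rootTree : TGraph := comb 0 .I .L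

/-- The identity rule `P ← P → P` with an application condition. -/
def idRule (P : TGraph) (cond : (X : TGraph) → Hom P X → Prop) : Rule where
  O := P
  K := P
  I := P
  o := ⟨id, id, fun _ => rfl, fun _ => rfl, fun _ => rfl⟩
  i := ⟨id, id, fun _ => rfl, fun _ => rfl, fun _ => rfl⟩
  o_mono := ⟨Function.injective_id, Function.injective_id⟩
  i_mono := ⟨Function.injective_id, Function.injective_id⟩
  cond := cond

/-- The number of occurrences in `X` of the combs with `n` inner nodes, summed over the type of
the first edge. -/
def combCount (n : ℕ) (s : Side) (X : TGraph) : ℕ :=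
  ∑ T : EdgeType, Nat.card {m : Hom (comb n T s) X // m.IsMono}

/-- The observable that counts combs with `n` inner nodes. -/
def obsComb (n : ℕ) (s : Side) : Op :=
  ∑ T : EdgeType, rho (idRule (comb n T s) fun _ _ => True)

/-- The graph `P` with its edge `e` removed. -/
def removeEdge (P : TGraph) (e : P.E) : TGraph where
  V := P.V
  E := {f : P.E // f ≠ e}
  finV := P.finV
  finE := inferInstance
  src := fun f => P.src f.1
  tgt := fun f => P.tgt f.1
  typ := fun f => P.typ f.1

/-- The graph `P` with its edge `e : u → w` replaced by an edge `u → y` of the same type to a new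
vertex `y = inr 0`, together with edges from `y` to a new leaf `inr 1`, of type `c`, and to `w`,
of the opposite type. -/
def insertLeaf (P : TGraph) (e : P.E) (c : Side) : TGraph where
  V := P.V ⊕ Fin 2
  E := {f : P.E // f ≠ e} ⊕ Fin 3
  finV := inferInstance
  finE := inferInstance
  src := Sum.elim (fun f => .inl (P.src f.1)) ![.inl (P.src e), .inr 0, .inr 0]
  tgt := Sum.elim (fun f => .inl (P.tgt f.1)) ![.inr 0, .inr 1, .inl (P.tgt e)]
  typ := Sum.elim (fun f => P.typ f.1) ![P.typ e, .of c, .of c.opp]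

/-- The rule that inserts a leaf on side `c` at the edge `e` of the pattern `P`, preserving all
vertices and all other edges of `P`. It applies to planar rooted binary forests. -/
def insertRule (P : TGraph) (e : P.E) (c : Side) : Rule where
  O := insertLeaf P e c
  K := removeEdge P e
  I := P
  o := ⟨Sum.inl, Sum.inl, fun _ => rfl, fun _ => rfl, fun _ => rfl⟩
  i := ⟨id, Subtype.val, fun _ => rfl, fun _ => rfl, fun _ => rfl⟩
  o_mono := ⟨Sum.inl_injective, Sum.inl_injective⟩
  i_mono := ⟨Function.injective_id, Subtype.val_injective⟩
  cond := fun X _ => IsPRBF X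

/-- Insertion of a leaf on side `c` at the edge number `j` of the path of a comb with `n` inner
nodes, summed over the type of the first edge. -/
def insertComb (n : ℕ) (s : Side) (j : Fin (n + 1)) (c : Side) : Op :=
  ∑ T : EdgeType, rho (insertRule (comb n T s) (.inl j) c)

/-- The part of the Rémy generator that inserts a left leaf at an arbitrary edge. -/
def genL : Op := insertComb 0 .L 0 .L

/-- The part of the Rémy generator that inserts a right leaf at an arbitrary edge. -/
def genR : Op := insertComb 0 .L 0 .R

/-- The Rémy generator. -/
def G : Op := genL + genR

/-- The edge-counting observable. -/
def OE : Op := obsComb 0 .L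

/-- The observable counting inner nodes (with their incoming edge and the edges to both children);
the side is irrelevant for this pattern. -/
def OP1 : Op := obsComb 1 .L

/-- The observable counting combs with two inner nodes. -/
def OP2 (s : Side) : Op := obsComb 2 s

/-- The observable counting combs with three inner nodes. -/
def OP3 (s : Side) : Op := obsComb 3 s

/-- The operator that inserts, for each comb with three inner nodes, a leaf on side `s` at the edge
between the first two inner nodes (which breaks the comb). -/
def RP3' (s : Side) : Op := insertComb 3 s 1 s

/-- The four observables. -/
def obs (s : Side) : Fin 4 → Op := ![OE, OP1, OP2 s, OP3 s]

/-- The four pattern counts. -/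
def counts (s : Side) (X : TGraph) : Fin 4 →₀ ℕ :=
  Finsupp.equivFunOnFinite.symm
    ![combCount 0 .L X, combCount 1 .L X, combCount 2 s X, combCount 3 s X]

/-- Equality of operators on the span of the planar rooted binary trees. -/
def EqOnTrees (A B : Op) : Prop := ∀ X, IsPRBT X → A (ket X) = B (ket X)

/-- `⟨|A = ⟨|B` on the span of the planar rooted binary trees. -/
def BraEqOnTrees (A B : Op) : Prop := ∀ X, IsPRBT X → bra (A (ket X)) = bra (B (ket X))

/-- `ω · Ô`. -/
def dotObs (s : Side) (ω : Fin 4 → ℝ) : Op := ∑ i, ω i • obs s i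

/-- The ordered product `Ô₀ ^ k₀ ⋯ Ô₃ ^ k₃`. -/
def obsPow (s : Side) (k : Fin 4 → ℕ) : Op := (List.ofFn fun i => obs s i ^ k i).prod

/-- Polynomial jump-closure of the four observables with respect to `G`, on the span of the planar
rooted binary trees. -/
def PolynomiallyJumpClosed (s : Side) : Prop :=
  ∀ q : ℕ, ∃ (N : Fin 4 → ℕ) (g : (Fin 4 → ℝ) → (Fin 4 → ℕ) → ℝ),
    ∀ ω : Fin 4 → ℝ,
      BraEqOnTrees ((fun B => ⁅dotObs s ω, B⁆)^[q] G)
        (∑ k ∈ Finset.Iic N, g ω k • obsPow s k)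

/-! ### Moment generating function -/

/-- The terms of the series `⟨|e^A v⟩ = ∑ₖ ⟨|A ^ k v⟩ / k!`. -/
def braExpTerm (A : Op) (v : Chat) (k : ℕ) : ℝ := (k ! : ℝ)⁻¹ * bra ((A ^ k) v)

/-- `𝒢(λ; ω) = ⟨|e^{ω · Ô} e^{λ G}|·⟩`, a formal power series in `λ`. -/
def egf (s : Side) (ω : Fin 4 → ℝ) : PowerSeries ℝ :=
  PowerSeries.mk fun n => (n ! : ℝ)⁻¹ * ∑' k, braExpTerm (dotObs s ω) ((G ^ n) (ket rootTree)) k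

/-- The partial derivative `∂𝒢 / ∂ω_i`, taken coefficientwise in `λ`. -/
def dEgf (s : Side) (i : Fin 4) (ω : Fin 4 → ℝ) : PowerSeries ℝ :=
  PowerSeries.mk fun n =>
    fderiv ℝ (fun w : Fin 4 → ℝ => PowerSeries.coeff n (egf s w)) ω (Pi.single i 1)

/-! ### Pattern count polynomials and discrete-time Markov chains -/

/-- Polynomials in the variables `x₀, x₁, x₂, x₃`, i.e. `x_ε, x_γ, x_μ, x_ν`. -/
abbrev Poly : Type := MvPolynomial (Fin 4) ℝ

/-- The operator `n_i = x_i ∂ / ∂x_i`. -/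
def num (i : Fin 4) : Poly →ₗ[ℝ] Poly :=
  LinearMap.mulLeft ℝ (MvPolynomial.X i) ∘ₗ (MvPolynomial.pderiv i).toLinearMap

/-- The generator `D = x_ε² x_γ ((2 n_ε - 3 n_γ + 2 n_μ - n_ν) + x_μ (3 n_γ - 6 n_μ + 3 n_ν)
+ x_μ x_ν (4 n_μ - 3 n_ν) + x_ν⁻¹ n_ν)`, where `x_ν⁻¹ n_ν = ∂ / ∂x_ν`. -/
def D : Poly →ₗ[ℝ] Poly :=
  LinearMap.mulLeft ℝ (MvPolynomial.X 0 ^ 2 * MvPolynomial.X 1) ∘ₗ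
    ((2 : ℝ) • num 0 - (3 : ℝ) • num 1 + (2 : ℝ) • num 2 - num 3
      + LinearMap.mulLeft ℝ (MvPolynomial.X 2) ∘ₗ
          ((3 : ℝ) • num 1 - (6 : ℝ) • num 2 + (3 : ℝ) • num 3)
      + LinearMap.mulLeft ℝ (MvPolynomial.X 2 * MvPolynomial.X 3) ∘ₗ
          ((4 : ℝ) • num 2 - (3 : ℝ) • num 3)
      + (MvPolynomial.pderiv 3).toLinearMap)

/-- The formal inverse of `2 n_ε`, set to the identity on the kernel. -/
def invTwoNum : Poly →ₗ[ℝ] Poly :=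
  (MvPolynomial.basisMonomials (Fin 4) ℝ).constr ℝ fun N =>
    if N 0 = 0 then MvPolynomial.monomial N 1 else MvPolynomial.monomial N (2 * (N 0 : ℝ))⁻¹

/-- The normalised generator `D (2 n_ε)⁻¹`. -/
def dPoly : Poly →ₗ[ℝ] Poly := D ∘ₗ invTwoNum

/-- The linear map `⟨|x^Ô`, with `⟨|x^Ô|X⟩ = x^{N(X)}`. -/
def braPow (s : Side) : Chat →ₗ[ℝ] Poly :=
  Finsupp.linearCombination ℝ fun c : IsoClass =>
    MvPolynomial.monomial (counts s (Quotient.out c)) (1 : ℝ)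

/-- The observable that counts the matches of the rules in `G`. -/
def OG : Op :=
  ∑ c : Side, ∑ T : EdgeType,
    rho (idRule (comb 0 T .L) (insertRule (comb 0 T .L) (.inl 0) c).cond)

open Classical in
/-- The formal inverse of `OG`, set to the identity where `G` vanishes. -/
def invOG : Op :=
  Finsupp.linearCombination ℝ fun c : IsoClass =>
    if G (Finsupp.single c 1) = 0 then Finsupp.single c 1
    else Finsupp.single c (bra (OG (Finsupp.single c 1)))⁻¹

/-- The generator of the embedded discrete-time Markov chain of `G`. -/
def dOp : Op := G * invOG

/-- `⟨|x^Ô e^{λ A}|·⟩`, a formal power series in `λ` whose coefficients are polynomials in `x`. -/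
def pgf (s : Side) (A : Op) : PowerSeries Poly :=
  PowerSeries.mk fun n => (n ! : ℝ)⁻¹ • braPow s ((A ^ n) (ket rootTree))

/-- The vector `v` is a probability distribution on (isomorphism classes of) planar rooted binary
trees. -/
def IsTreeDistribution (v : Chat) : Prop :=
  (∀ c, 0 ≤ v c) ∧ (∀ c, v c ≠ 0 → ∃ X, IsPRBT X ∧ Quotient.mk isoSetoid X = c) ∧ bra v = 1

/-- The set of pattern counts of planar rooted binary trees. -/
def treeCounts (s : Side) : Set (Fin 4 →₀ ℕ) := {N | ∃ X, IsPRBT X ∧ counts s X = N}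

/-- The operator `A` on polynomials is the generator of a discrete-time Markov chain on the set `S`
of exponents: the coefficient of `x^M` in `A x^N` is the probability of the step from `N ∈ S`
to `M`. -/
def IsDTMCGenerator (S : Set (Fin 4 →₀ ℕ)) (A : Poly →ₗ[ℝ] Poly) : Prop :=
  ∀ N ∈ S,
    (∀ M, 0 ≤ (A (MvPolynomial.monomial N 1)).coeff M) ∧
    (∀ M, (A (MvPolynomial.monomial N 1)).coeff M ≠ 0 → M ∈ S) ∧
    ∑ M ∈ (A (MvPolynomial.monomial N 1)).support, (A (MvPolynomial.monomial N 1)).coeff M = 1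

end PRBT

end

open PRBT

/-!
Inserting a leaf at an edge `f : u → w` on a side `c` of a tree changes the pattern counts only
through the `s`-path on which `f` lies. In a forest every edge has at most one `s`-child (an edge
of type `s` that leaves its target) and is the `s`-child of at most one edge, and the sibling and
uniqueness conditions make the combs with `n` inner nodes the same thing as the paths of `n` steps
to an `s`-child (`comb_path_bijective`). Let `asc j f`, `desc k f ∈ {0, 1}` say whether there are
`j` such steps up to `f`, respectively `k` steps down from `f`. Cutting a path at its edge number
`j` shows that `f` is in that position in `asc j f * desc (n - j) f` combs, so that the sum of
this product over all `f` is the number of combs (`combCount_eq_sum`) and the operator `insertComb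
n s j c` weighs the insertion at `f` with it (`insertComb_ket`).

The counts of the new tree follow from the recursion for `desc`: nothing changes below `f`, and
the change at `f` is passed up along the path (`sum_mul_descDiff_succ`). The counts of edges, of
inner nodes, and of combs with two and three inner nodes therefore grow by `2`, `1`, `delta2` and
`delta3`, explicit polynomials in `asc` and `desc`. The observables are diagonal, so a commutator
with one of them multiplies the weight of each insertion by the increment of the count
(`HasRep.lie`), and the commutator identities become identities between polynomials in numbers
that are `0` or `1`.

All the remaining statements rest on `sum_delta`: the pair `(delta2, delta3)` takes only the
values `(0, 0)`, `(1, 0)`, `(1, 1)` and `(0, -1)`, and the number of insertions with each value is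
a linear function of the four counts. Summing powers of `ω · delta` gives the jump-closure,
summing exponentials gives the evolution equation, and summing monomials shows that the operator
`D` describes the action of `G` on the pattern counts (`braPow_G`). The last fact, divided by the
number `2 N₀` of insertions, gives the Markov chain. Power series identities reduce to single
trees because `G` preserves the span of the trees.
-/

noncomputable section

namespace PRBT

open scoped Classical

/-! ### Isomorphisms and the canonical representation -/

/-- The edges of a graph as a finite type. -/
instance edgeFintype (X : TGraph) : Fintype X.E := Fintype.ofFinite _

/-- Composition of morphisms of typed graphs. -/
def Hom.comp {X Y Z : TGraph} (g : Hom Y Z) (f : Hom X Y) : Hom X Z where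
  fV := g.fV ∘ f.fV
  fE := g.fE ∘ f.fE
  src_comm e := (g.src_comm _).trans (congrArg g.fV (f.src_comm e))
  tgt_comm e := (g.tgt_comm _).trans (congrArg g.fV (f.tgt_comm e))
  typ_comm e := (g.typ_comm _).trans (f.typ_comm e)

/-- The morphism is an isomorphism: it is bijective on vertices and on edges. -/
def Hom.IsIso {X Y : TGraph} (f : Hom X Y) : Prop :=
  Function.Bijective f.fV ∧ Function.Bijective f.fE

theorem Hom.IsIso.exists_inverse {X Y : TGraph} {f : Hom X Y} (hf : f.IsIso) :
    ∃ g : Hom Y X, g.IsIso ∧ (∀ v, f.fV (g.fV v) = v) ∧ ∀ e, f.fE (g.fE e) = e := by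
  obtain ⟨hV, hE⟩ := hf
  let v := Equiv.ofBijective _ hV
  let e := Equiv.ofBijective _ hE
  have he : ∀ x, f.fE (e.symm x) = x := fun x => e.apply_symm_apply x
  refine ⟨⟨v.symm, e.symm, fun x => ?_, fun x => ?_, fun x => ?_⟩,
    ⟨v.symm.bijective, e.symm.bijective⟩, fun x => v.apply_symm_apply x, he⟩
  · rw [eq_comm, Equiv.symm_apply_eq]
    exact (congrArg Y.src (he x)).symm.trans (f.src_comm _)
  · rw [eq_comm, Equiv.symm_apply_eq]
    exact (congrArg Y.tgt (he x)).symm.trans (f.tgt_comm _)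
  · exact (f.typ_comm _).symm.trans (congrArg Y.typ (he x))

theorem Hom.IsMono.comp {X Y Z : TGraph} {g : Hom Y Z} {f : Hom X Y} (hg : g.IsMono)
    (hf : f.IsMono) : (g.comp f).IsMono :=
  ⟨hg.1.comp hf.1, hg.2.comp hf.2⟩

theorem Hom.IsIso.isMono {X Y : TGraph} {f : Hom X Y} (hf : f.IsIso) : f.IsMono :=
  ⟨hf.1.1, hf.2.1⟩

theorem ket_eq_of_iso {X Y : TGraph} (h : Iso X Y) : ket X = ket Y := by
  unfold ket
  rw [Quotient.sound h]

theorem linearCombination_ket {M : Type*} [AddCommGroup M] [Module ℝ M] (v : IsoClass → M)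
    (X : TGraph) : Finsupp.linearCombination ℝ v (ket X) = v (Quotient.mk isoSetoid X) :=
  (Finsupp.linearCombination_single ℝ (1 : ℝ) _).trans (one_smul ℝ _)

@[simp]
theorem bra_ket (X : TGraph) : bra (ket X) = 1 :=
  linearCombination_ket _ X

theorem ket_ne_zero (X : TGraph) : ket X ≠ 0 := by
  intro h
  have := bra_ket X
  simp [h] at this

/-- The canonical representation may be computed in any representative of an isomorphism class,
provided that the results `F X m` of the rewriting steps and the condition on matches are invariant
under isomorphism. -/
theorem rho_ket (r : Rule) (F : ∀ X, Hom r.I X → Chat)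
    (hF : ∀ X (m : Match r X), ket (rewrite m) = F X m.1)
    (hinv : ∀ {X Y} (θ : Hom X Y), θ.IsIso → ∀ m, F Y (θ.comp m) = F X m)
    (hc : ∀ {X Y} (θ : Hom X Y), θ.IsIso → ∀ m, r.cond X m → r.cond Y (θ.comp m))
    (X : TGraph) : rho r (ket X) = ∑ m : Match r X, F X m.1 := by
  set Y := Quotient.out (Quotient.mk isoSetoid X) with hY
  have h : Iso Y X := Quotient.exact (s := isoSetoid) (Quotient.out_eq _)
  have h1 : rho r (ket X) = ∑ m : Match r Y, ket (rewrite m) :=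
    linearCombination_ket _ X
  obtain ⟨θ, hθ⟩ := h
  have hθ : θ.IsIso := hθ
  obtain ⟨η, hη, hv, he⟩ := hθ.exists_inverse
  rw [h1]
  refine Fintype.sum_bijective (ι := Match r Y) (κ := Match r X)
    (fun m : Match r Y => (⟨θ.comp m.1, hθ.isMono.comp m.2.1, hc θ hθ _ m.2.2⟩ : Match r X))
    ⟨?_, ?_⟩ _ _ ?_
  · intro a b hab
    have hab : θ.comp a.1 = θ.comp b.1 := congrArg Subtype.val hab
    refine Subtype.ext (Hom.ext ?_ ?_)
    · exact hθ.1.1.comp_left (congrArg Hom.fV hab)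
    · exact hθ.2.1.comp_left (congrArg Hom.fE hab)
  · intro m
    refine ⟨⟨η.comp m.1, hη.isMono.comp m.2.1, hc η hη _ m.2.2⟩, Subtype.ext (Hom.ext ?_ ?_)⟩
    · exact funext fun x => hv _
    · exact funext fun x => he _
  · intro m
    rw [hF]
    exact (hinv θ hθ m.1).symm

theorem rewrite_idRule_iso {P : TGraph} {cond : (X : TGraph) → Hom P X → Prop} {X : TGraph}
    (m : Match (idRule P cond) X) : Iso X (rewrite m) := by
  have hV : ∀ v, KeepV m v := fun v a _ => ⟨a, rfl⟩
  have hE : ∀ e, KeepE m e := fun e => ⟨fun a _ => ⟨a, rfl⟩, hV _, hV _⟩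
  refine ⟨⟨fun v => .inl ⟨v, hV v⟩, fun e => .inl ⟨e, hE e⟩, fun _ => rfl, fun _ => rfl,
    fun _ => rfl⟩, ⟨?_, ?_⟩, ⟨?_, ?_⟩⟩
  · intro a b hab
    exact congrArg Subtype.val (Sum.inl_injective hab)
  · rintro (⟨v, hv⟩ | ⟨v, hv⟩)
    · exact ⟨v, rfl⟩
    · exact (hv ⟨v, rfl⟩).elim
  · intro a b hab
    exact congrArg Subtype.val (Sum.inl_injective hab)
  · rintro (⟨v, hv⟩ | ⟨v, hv⟩)
    · exact ⟨v, rfl⟩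
    · exact (hv ⟨v, rfl⟩).elim

theorem rho_idRule_ket (P : TGraph) (cond : (X : TGraph) → Hom P X → Prop)
    (hc : ∀ {X Y} (θ : Hom X Y), θ.IsIso → ∀ m, cond X m → cond Y (θ.comp m)) (X : TGraph) :
    rho (idRule P cond) (ket X) = (Nat.card (Match (idRule P cond) X) : ℝ) • ket X := by
  rw [rho_ket (idRule P cond) (fun X _ => ket X)
    (fun X m => (ket_eq_of_iso (rewrite_idRule_iso m)).symm)
    (fun θ hθ _ => (ket_eq_of_iso ⟨θ, hθ⟩).symm) hc X]
  simp [Nat.card_eq_fintype_card, Nat.cast_smul_eq_nsmul]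

theorem obsComb_ket (n : ℕ) (s : Side) (X : TGraph) :
    obsComb n s (ket X) = (combCount n s X : ℝ) • ket X := by
  simp only [obsComb, LinearMap.sum_apply, combCount, Nat.cast_sum, Finset.sum_smul]
  refine Finset.sum_congr rfl fun T _ => ?_
  rw [rho_idRule_ket _ _ fun _ _ _ _ => trivial]
  congr 2
  refine Nat.card_congr (Equiv.subtypeEquivRight fun m => ?_)
  simp [idRule]

theorem combCount_eq_of_iso (n : ℕ) (s : Side) {X Y : TGraph} (h : Iso X Y) :
    combCount n s X = combCount n s Y := by
  have h1 := obsComb_ket n s X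
  rw [ket_eq_of_iso h, obsComb_ket] at h1
  exact_mod_cast (smul_left_injective ℝ (ket_ne_zero Y) h1).symm

theorem obs_ket (s : Side) (i : Fin 4) (X : TGraph) :
    obs s i (ket X) = (counts s X i : ℝ) • ket X := by
  fin_cases i <;> exact obsComb_ket _ _ X

theorem counts_eq_of_iso (s : Side) {X Y : TGraph} (h : Iso X Y) : counts s X = counts s Y := by
  simp only [counts, combCount_eq_of_iso _ _ h]

@[simp]
theorem braPow_ket (s : Side) (X : TGraph) :
    braPow s (ket X) = MvPolynomial.monomial (counts s X) 1 := by
  have h : Iso (Quotient.out (Quotient.mk isoSetoid X)) X :=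
    Quotient.exact (s := isoSetoid) (Quotient.out_eq _)
  rw [← counts_eq_of_iso s h]
  exact linearCombination_ket _ X

/-! ### Insertion of a leaf -/

theorem comatchV_inl {P : TGraph} {e : P.E} {c : Side} {X : TGraph}
    (m : Match (insertRule P e c) X) (v : P.V) (h : KeepV m (m.1.fV v)) :
    comatchV m (.inl v) = .inl ⟨m.1.fV v, h⟩ := by
  have hv : (Sum.inl v : P.V ⊕ Fin 2) ∈ Set.range (insertRule P e c).o.fV := ⟨v, rfl⟩
  have h2 : (insertRule P e c).o.fV hv.choose = Sum.inl v := hv.choose_spec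
  have h3 : hv.choose = v := Sum.inl_injective h2
  exact (dif_pos hv).trans (congrArg Sum.inl (Subtype.ext (congrArg m.1.fV h3)))

theorem comatchV_inr {P : TGraph} {e : P.E} {c : Side} {X : TGraph}
    (m : Match (insertRule P e c) X) (i : Fin 2)
    (h : (Sum.inr i : P.V ⊕ Fin 2) ∉ Set.range (insertRule P e c).o.fV) :
    comatchV m (.inr i) = .inr ⟨.inr i, h⟩ :=
  dif_neg h

/-- Rewriting with an insertion rule inserts a leaf at the image of the edge. -/
theorem rewrite_insertRule_iso {P : TGraph} {e : P.E} {c : Side} {X : TGraph}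
    (m : Match (insertRule P e c) X) : Iso (insertLeaf X (m.1.fE e) c) (rewrite m) := by
  have hV : ∀ v, KeepV m v := fun v a _ => ⟨a, rfl⟩
  have hE : ∀ f, f ≠ m.1.fE e → KeepE m f := fun f hf =>
    ⟨fun a ha => ⟨⟨a, fun h => hf (by rw [← ha, h])⟩, rfl⟩, hV _, hV _⟩
  have hE' : ∀ f, KeepE m f → f ≠ m.1.fE e := by
    rintro f ⟨h, -⟩ rfl
    obtain ⟨⟨a, ha⟩, h'⟩ := h e rfl
    exact ha h'
  have hrV : ∀ i : Fin 2, (Sum.inr i : P.V ⊕ Fin 2) ∉ Set.range (insertRule P e c).o.fV := by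
    rintro i ⟨v, hv⟩
    exact Sum.inl_ne_inr hv
  have hrE : ∀ i : Fin 3,
      (Sum.inr i : {f : P.E // f ≠ e} ⊕ Fin 3) ∉ Set.range (insertRule P e c).o.fE := by
    rintro i ⟨v, hv⟩
    exact Sum.inl_ne_inr hv
  let fV : (insertLeaf X (m.1.fE e) c).V → (rewrite m).V :=
    Sum.elim (fun v => .inl ⟨v, hV v⟩) (fun i => .inr ⟨.inr i, hrV i⟩)
  let fE : (insertLeaf X (m.1.fE e) c).E → (rewrite m).E :=
    Sum.elim (fun f => .inl ⟨f.1, hE f.1 f.2⟩) (fun i => .inr ⟨.inr i, hrE i⟩)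
  refine ⟨⟨fV, fE, ?_, ?_, ?_⟩, ⟨?_, ?_⟩, ⟨?_, ?_⟩⟩
  · rintro (f | i)
    · rfl
    · fin_cases i
      · exact (comatchV_inl m _ (hV _)).trans (congrArg Sum.inl (Subtype.ext (m.1.src_comm e).symm))
      · exact comatchV_inr m _ (hrV 0)
      · exact comatchV_inr m _ (hrV 0)
  · rintro (f | i)
    · rfl
    · fin_cases i
      · exact comatchV_inr m _ (hrV 0)
      · exact comatchV_inr m _ (hrV 1)
      · exact (comatchV_inl m _ (hV _)).trans (congrArg Sum.inl (Subtype.ext (m.1.tgt_comm e).symm))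
  · rintro (f | i)
    · rfl
    · fin_cases i
      · exact (m.1.typ_comm e).symm
      · rfl
      · rfl
  · rintro (a | a) (b | b) hab
    · exact congrArg Sum.inl (congrArg Subtype.val (Sum.inl_injective hab))
    · exact (Sum.inl_ne_inr hab).elim
    · exact (Sum.inr_ne_inl hab).elim
    · have := congrArg Subtype.val (Sum.inr_injective hab)
      exact congrArg Sum.inr (Sum.inr_injective this)
  · rintro (⟨v, hv⟩ | ⟨v | i, hv⟩)
    · exact ⟨.inl v, rfl⟩
    · exact (hv ⟨v, rfl⟩).elim
    · exact ⟨.inr i, rfl⟩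
  · rintro (a | a) (b | b) hab
    · have := congrArg Subtype.val (Sum.inl_injective (β := {x // x ∉ _}) hab)
      exact congrArg Sum.inl (Subtype.ext this)
    · exact (Sum.inl_ne_inr hab).elim
    · exact (Sum.inr_ne_inl hab).elim
    · have := congrArg Subtype.val (Sum.inr_injective hab)
      exact congrArg Sum.inr (Sum.inr_injective this)
  · rintro (⟨f, hf⟩ | ⟨f | i, hf⟩)
    · exact ⟨.inl ⟨f, hE' f hf⟩, rfl⟩
    · exact (hf ⟨f, rfl⟩).elim
    · exact ⟨.inr i, rfl⟩

theorem insertLeaf_iso {X Y : TGraph} {θ : Hom X Y} (hθ : θ.IsIso) (f : X.E) (c : Side) :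
    Iso (insertLeaf X f c) (insertLeaf Y (θ.fE f) c) := by
  let fV : (insertLeaf X f c).V → (insertLeaf Y (θ.fE f) c).V := Sum.map θ.fV id
  let fE : (insertLeaf X f c).E → (insertLeaf Y (θ.fE f) c).E :=
    Sum.map (fun e => ⟨θ.fE e.1, fun h => e.2 (hθ.2.1 h)⟩) id
  refine ⟨⟨fV, fE, ?_, ?_, ?_⟩, ⟨?_, ?_⟩, ⟨?_, ?_⟩⟩
  · rintro (e | i)
    · exact congrArg Sum.inl (θ.src_comm e.1)
    · fin_cases i
      · exact congrArg Sum.inl (θ.src_comm f)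
      · rfl
      · rfl
  · rintro (e | i)
    · exact congrArg Sum.inl (θ.tgt_comm e.1)
    · fin_cases i
      · rfl
      · rfl
      · exact congrArg Sum.inl (θ.tgt_comm f)
  · rintro (e | i)
    · exact θ.typ_comm e.1
    · fin_cases i
      · exact θ.typ_comm f
      · rfl
      · rfl
  · exact Sum.map_injective.2 ⟨hθ.1.1, Function.injective_id⟩
  · exact Sum.map_surjective.2 ⟨hθ.1.2, Function.surjective_id⟩
  · refine Sum.map_injective.2 ⟨fun a b hab => Subtype.ext (hθ.2.1 ?_), Function.injective_id⟩
    exact congrArg Subtype.val hab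
  · refine Sum.map_surjective.2 ⟨?_, Function.surjective_id⟩
    rintro ⟨e, he⟩
    obtain ⟨e, rfl⟩ := hθ.2.2 e
    exact ⟨⟨e, fun h => he (congrArg θ.fE h)⟩, rfl⟩

/-! ### Planar rooted binary forests -/

/-- A finite directed graph without cycles has a height function that increases along edges. -/
theorem IsPRBF.exists_height {X : TGraph} (h : IsPRBF X) :
    ∃ r : X.V → ℕ, ∀ e, r (X.src e) < r (X.tgt e) := by
  refine ⟨fun v => Set.ncard {u | Relation.TransGen X.Step u v}, fun e => ?_⟩
  have hs : X.Step (X.src e) (X.tgt e) := ⟨e, rfl, rfl⟩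
  refine Set.ncard_lt_ncard ⟨fun u hu => Relation.TransGen.tail hu hs, fun hsub => ?_⟩
    (Set.toFinite _)
  exact h.acyclic _ (hsub (Relation.TransGen.single hs))

theorem acyclic_of_height {X : TGraph} (r : X.V → ℕ) (hr : ∀ e, r (X.src e) < r (X.tgt e))
    (v : X.V) : ¬ Relation.TransGen X.Step v v := by
  have key : ∀ a b, Relation.TransGen X.Step a b → r a < r b := by
    intro a b hab
    induction hab with
    | single h => obtain ⟨e, rfl, rfl⟩ := h; exact hr e
    | tail _ h ih => obtain ⟨e, rfl, rfl⟩ := h; exact ih.trans (hr e)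
  exact fun h => lt_irrefl _ (key v v h)

theorem IsPRBF.of_isIso {X Y : TGraph} {θ : Hom X Y} (hθ : θ.IsIso) (h : IsPRBF X) :
    IsPRBF Y := by
  have hs := hθ.2.2
  obtain ⟨r, hr⟩ := h.exists_height
  obtain ⟨η, -, hv, he⟩ := hθ.exists_inverse
  refine ⟨?_, ?_, ?_, ?_, acyclic_of_height (fun v => r (η.fV v)) fun e => ?_, ?_, ?_⟩
  · refine hs.forall.2 fun e => hs.forall.2 fun e' heq => ?_
    rw [θ.tgt_comm, θ.tgt_comm] at heq
    rw [h.in_unique e e' (hθ.1.1 heq)]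
  · refine hs.forall.2 fun e => hs.forall.2 fun e' heq ht => ?_
    rw [θ.src_comm, θ.src_comm] at heq
    rw [θ.typ_comm, θ.typ_comm] at ht
    rw [h.out_unique e e' (hθ.1.1 heq) ht]
  · refine hs.forall.2 fun e => hs.forall.2 fun e' ht heq => ?_
    rw [θ.src_comm, θ.src_comm] at heq
    rw [θ.typ_comm] at ht
    rw [h.root_out e e' ht (hθ.1.1 heq)]
  · refine hs.forall.2 fun e => hs.forall.2 fun e' ht heq => ?_
    rw [θ.src_comm, θ.tgt_comm] at heq
    rw [θ.typ_comm] at ht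
    exact h.root_in e e' ht (hθ.1.1 heq)
  · rw [← η.src_comm, ← η.tgt_comm]
    exact hr _
  · refine hs.forall.2 fun e c ht => ?_
    rw [θ.typ_comm] at ht
    obtain ⟨e', h1, h2⟩ := h.sibling e c ht
    exact ⟨θ.fE e', by rw [θ.src_comm, θ.src_comm, h1], by rw [θ.typ_comm, h2]⟩
  · refine hs.forall.2 fun e c ht => ?_
    rw [θ.typ_comm] at ht
    obtain ⟨e', h1⟩ := h.parent e c ht
    exact ⟨θ.fE e', by rw [θ.src_comm, θ.tgt_comm, h1]⟩

theorem rho_insertRule_ket (P : TGraph) (e : P.E) (c : Side) (X : TGraph) :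
    rho (insertRule P e c) (ket X)
      = ∑ m : Match (insertRule P e c) X, ket (insertLeaf X (m.1.fE e) c) :=
  rho_ket (insertRule P e c) (fun X m => ket (insertLeaf X (m.fE e) c))
    (fun _ m => (ket_eq_of_iso (rewrite_insertRule_iso m)).symm)
    (fun _ hθ m => (ket_eq_of_iso (insertLeaf_iso hθ (m.fE e) c)).symm)
    (fun _ hθ _ h => IsPRBF.of_isIso hθ h) X

section InsertLeaf

variable {X : TGraph} {f : X.E} {c : Side}

/-- An old vertex of the graph with an inserted leaf. -/
def oldV (v : X.V) : (insertLeaf X f c).V := .inl v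

/-- The new inner node. -/
def nodeV : (insertLeaf X f c).V := .inr 0

/-- The new leaf. -/
def leafV : (insertLeaf X f c).V := .inr 1

/-- An old edge other than the one at which the leaf is inserted. -/
def oldE (e : X.E) (he : e ≠ f) : (insertLeaf X f c).E := .inl ⟨e, he⟩

/-- The edge from the source of the subdivided edge to the new inner node. -/
def upE : (insertLeaf X f c).E := .inr 0

/-- The edge from the new inner node to the new leaf. -/
def leafE : (insertLeaf X f c).E := .inr 1

/-- The edge from the new inner node to the target of the subdivided edge. -/
def downE : (insertLeaf X f c).E := .inr 2

@[simp] theorem src_oldE (e : X.E) (he : e ≠ f) :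
    (insertLeaf X f c).src (oldE e he) = oldV (X.src e) := rfl
@[simp] theorem tgt_oldE (e : X.E) (he : e ≠ f) :
    (insertLeaf X f c).tgt (oldE e he) = oldV (X.tgt e) := rfl
@[simp] theorem typ_oldE (e : X.E) (he : e ≠ f) :
    (insertLeaf X f c).typ (oldE e he) = X.typ e := rfl
@[simp] theorem src_upE : (insertLeaf X f c).src upE = oldV (X.src f) := rfl
@[simp] theorem tgt_upE : (insertLeaf X f c).tgt upE = nodeV := rfl
@[simp] theorem typ_upE : (insertLeaf X f c).typ upE = X.typ f := rfl
@[simp] theorem src_leafE : (insertLeaf X f c).src leafE = nodeV := rfl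
@[simp] theorem tgt_leafE : (insertLeaf X f c).tgt leafE = leafV := rfl
@[simp] theorem typ_leafE : (insertLeaf X f c).typ leafE = .of c := rfl
@[simp] theorem src_downE : (insertLeaf X f c).src downE = nodeV := rfl
@[simp] theorem tgt_downE : (insertLeaf X f c).tgt downE = oldV (X.tgt f) := rfl
@[simp] theorem typ_downE : (insertLeaf X f c).typ downE = .of c.opp := rfl

@[simp] theorem oldV_inj {u v : X.V} :
    (oldV u : (insertLeaf X f c).V) = oldV v ↔ u = v := Sum.inl_injective.eq_iff
@[simp] theorem oldV_ne_nodeV (v : X.V) : (oldV v : (insertLeaf X f c).V) ≠ nodeV :=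
  Sum.inl_ne_inr
@[simp] theorem oldV_ne_leafV (v : X.V) : (oldV v : (insertLeaf X f c).V) ≠ leafV :=
  Sum.inl_ne_inr
@[simp] theorem nodeV_ne_oldV (v : X.V) : (nodeV : (insertLeaf X f c).V) ≠ oldV v :=
  Sum.inr_ne_inl
@[simp] theorem leafV_ne_oldV (v : X.V) : (leafV : (insertLeaf X f c).V) ≠ oldV v :=
  Sum.inr_ne_inl
@[simp] theorem nodeV_ne_leafV : (nodeV : (insertLeaf X f c).V) ≠ leafV :=
  fun h => zero_ne_one (Sum.inr_injective h)
@[simp] theorem leafV_ne_nodeV : (leafV : (insertLeaf X f c).V) ≠ nodeV :=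
  fun h => one_ne_zero (Sum.inr_injective h)

@[simp] theorem Side.opp_ne (c : Side) : c.opp ≠ c := by cases c <;> simp [Side.opp]
@[simp] theorem Side.ne_opp (c : Side) : c ≠ c.opp := (Side.opp_ne c).symm
@[simp] theorem Side.opp_opp (c : Side) : c.opp.opp = c := by cases c <;> rfl

theorem insertLeaf_edge_cases (e : (insertLeaf X f c).E) :
    (∃ e' h, e = oldE e' h) ∨ e = upE ∨ e = leafE ∨ e = downE := by
  rcases e with ⟨e, h⟩ | i
  · exact .inl ⟨e, h, rfl⟩
  · fin_cases i
    · exact .inr (.inl rfl)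
    · exact .inr (.inr (.inl rfl))
    · exact .inr (.inr (.inr rfl))

theorem insertLeaf_vertex_cases (v : (insertLeaf X f c).V) :
    (∃ v', v = oldV v') ∨ v = nodeV ∨ v = leafV := by
  rcases v with v | i
  · exact .inl ⟨v, rfl⟩
  · fin_cases i
    · exact .inr (.inl rfl)
    · exact .inr (.inr rfl)

/-- The edge that takes the place of the old edge `e` at its source. -/
def liftE (f : X.E) (c : Side) (e : X.E) : (insertLeaf X f c).E :=
  if h : e = f then upE else oldE e h

@[simp] theorem liftE_self : liftE f c f = upE := dif_pos rfl
theorem liftE_of_ne {e : X.E} (h : e ≠ f) : liftE f c e = oldE e h := dif_neg h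

@[simp] theorem src_liftE (e : X.E) :
    (insertLeaf X f c).src (liftE f c e) = oldV (X.src e) := by
  by_cases h : e = f
  · subst h; simp
  · simp [liftE_of_ne h]

@[simp] theorem typ_liftE (e : X.E) :
    (insertLeaf X f c).typ (liftE f c e) = X.typ e := by
  by_cases h : e = f
  · subst h; simp
  · simp [liftE_of_ne h]

theorem exists_tgt_eq_oldV (e : X.E) :
    ∃ e', (insertLeaf X f c).tgt e' = oldV (X.tgt e) := by
  by_cases h : e = f
  · exact ⟨downE, by simp [h]⟩
  · exact ⟨oldE e h, by simp⟩

theorem insertLeaf_edge_cases' (e : (insertLeaf X f c).E) :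
    (∃ e', e = liftE f c e') ∨ e = leafE ∨ e = downE := by
  rcases insertLeaf_edge_cases e with ⟨e, h, rfl⟩ | rfl | rfl | rfl
  · exact .inl ⟨e, (liftE_of_ne h).symm⟩
  · exact .inl ⟨f, liftE_self.symm⟩
  · exact .inr (.inl rfl)
  · exact .inr (.inr rfl)

theorem IsPRBF.insertLeaf (hX : IsPRBF X) (f : X.E) (c : Side) : IsPRBF (insertLeaf X f c) := by
  obtain ⟨r, hr⟩ := hX.exists_height
  -- Doubling the height makes room for the new inner node.
  let r' : (PRBT.insertLeaf X f c).V → ℕ :=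
    Sum.elim (fun v => 2 * r v) ![2 * r (X.src f) + 1, 2 * r (X.src f) + 2]
  have hold : ∀ v, r' (oldV v) = 2 * r v := fun _ => rfl
  have hnode : r' nodeV = 2 * r (X.src f) + 1 := rfl
  have hleaf : r' leafV = 2 * r (X.src f) + 2 := rfl
  refine ⟨?_, ?_, ?_, ?_, acyclic_of_height r' ?_, ?_, ?_⟩
  · intro e e' h
    rcases insertLeaf_edge_cases e with ⟨e, he, rfl⟩ | rfl | rfl | rfl <;>
    rcases insertLeaf_edge_cases e' with ⟨e', he', rfl⟩ | rfl | rfl | rfl <;> simp at h ⊢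
    · obtain rfl := hX.in_unique e e' h
      rfl
    · exact (he (hX.in_unique _ _ h)).elim
    · exact (he' (hX.in_unique _ _ h).symm).elim
  · intro e e' h ht
    rcases insertLeaf_edge_cases' e with ⟨e, rfl⟩ | rfl | rfl <;>
    rcases insertLeaf_edge_cases' e' with ⟨e', rfl⟩ | rfl | rfl <;> simp at h ht ⊢
    rw [hX.out_unique e e' h ht]
  · intro e e' ht h
    rcases insertLeaf_edge_cases' e with ⟨e, rfl⟩ | rfl | rfl <;>
    rcases insertLeaf_edge_cases' e' with ⟨e', rfl⟩ | rfl | rfl <;> simp at h ht ⊢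
    rw [hX.root_out e e' ht h]
  · intro e e' ht h
    rcases insertLeaf_edge_cases' e with ⟨e, rfl⟩ | rfl | rfl <;>
    rcases insertLeaf_edge_cases e' with ⟨e', he', rfl⟩ | rfl | rfl | rfl <;> simp at h ht
    · exact hX.root_in e e' ht h
    · exact hX.root_in e f ht h
  · intro e
    rcases insertLeaf_edge_cases e with ⟨e, he, rfl⟩ | rfl | rfl | rfl
    · simp only [src_oldE, tgt_oldE, hold]; have := hr e; omega
    · simp only [src_upE, tgt_upE, hold, hnode]; omega
    · simp only [src_leafE, tgt_leafE, hleaf, hnode]; omega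
    · simp only [src_downE, tgt_downE, hold, hnode]; have := hr f; omega
  · intro e d ht
    rcases insertLeaf_edge_cases' e with ⟨e, rfl⟩ | rfl | rfl
    · obtain ⟨e', h1, h2⟩ := hX.sibling e d (by simpa using ht)
      exact ⟨liftE f c e', by simp [h1], by simp [h2]⟩
    · obtain rfl : c = d := by simpa using ht
      exact ⟨downE, by simp, by simp⟩
    · obtain rfl : c.opp = d := by simpa using ht
      exact ⟨leafE, by simp, by simp⟩
  · intro e d ht
    rcases insertLeaf_edge_cases' e with ⟨e, rfl⟩ | rfl | rfl
    · obtain ⟨e', h1⟩ := hX.parent e d (by simpa using ht)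
      rw [src_liftE, ← h1]
      exact exists_tgt_eq_oldV e'
    · exact ⟨upE, by simp⟩
    · exact ⟨upE, by simp⟩

theorem IsPRBT.insertLeaf (hX : IsPRBT X) (f : X.E) (c : Side) : IsPRBT (insertLeaf X f c) := by
  have hstep : ∀ e, (PRBT.insertLeaf X f c).Step ((PRBT.insertLeaf X f c).src e)
    ((PRBT.insertLeaf X f c).tgt e) := fun e => ⟨e, rfl, rfl⟩
  have hup := hstep upE
  have hleaf := hstep leafE
  have hdown := hstep downE
  simp only [src_upE, tgt_upE, src_leafE, tgt_leafE, src_downE, tgt_downE] at hup hleaf hdown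
  have key : ∀ u v, Relation.EqvGen X.Step u v →
      Relation.EqvGen (PRBT.insertLeaf X f c).Step (oldV u) (oldV v) := by
    intro u v h
    induction h with
    | rel u v h =>
      obtain ⟨e, rfl, rfl⟩ := h
      by_cases he : e = f
      · subst he
        exact .trans _ _ _ (.rel _ _ hup) (.rel _ _ hdown)
      · exact .rel _ _ (hstep (oldE e he))
    | refl u => exact .refl _
    | symm u v _ ih => exact .symm _ _ ih
    | trans u v w _ _ ih1 ih2 => exact .trans _ _ _ ih1 ih2
  have hroot : ∀ v, Relation.EqvGen (PRBT.insertLeaf X f c).Step (oldV (X.src f)) v := by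
    intro v
    rcases insertLeaf_vertex_cases v with ⟨v, rfl⟩ | rfl | rfl
    · exact key _ _ (hX.connected _ _)
    · exact .rel _ _ hup
    · exact .trans _ _ _ (.rel _ _ hup) (.rel _ _ hleaf)
  exact ⟨hX.forest.insertLeaf f c, ⟨upE⟩, fun u v => .trans _ _ _ (.symm _ _ (hroot u)) (hroot v)⟩

/-- A sum over the edges of the graph with an inserted leaf. -/
theorem sum_insertLeaf {M : Type*} [AddCommMonoid M] (F : (insertLeaf X f c).E → M) :
    ∑ e, F e = ∑ e, F (liftE f c e) + F leafE + F downE := by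
  have h1 : ∑ e, F e = ∑ e : {e : X.E // e ≠ f}, F (oldE e.1 e.2)
      + (F upE + F leafE + F downE) := by
    let F' : {e : X.E // e ≠ f} ⊕ Fin 3 → M := F
    let η : (insertLeaf X f c).E ≃ {e : X.E // e ≠ f} ⊕ Fin 3 := Equiv.refl _
    exact (Fintype.sum_equiv η F F' fun _ => rfl).trans
      ((Fintype.sum_sum_type F').trans (congrArg _ (Fin.sum_univ_three _)))
  have h2 : ∑ e, F (liftE f c e)
      = F upE + ∑ e : {e : X.E // e ≠ f}, F (oldE e.1 e.2) := by
    rw [← Finset.add_sum_erase _ _ (Finset.mem_univ f), liftE_self]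
    congr 1
    rw [Finset.sum_subtype (p := fun e => e ≠ f) _ (by simp)]
    exact Finset.sum_congr rfl fun e _ => by rw [liftE_of_ne e.2]
  rw [h1, h2]
  abel

end InsertLeaf

theorem isPRBT_rootTree : IsPRBT rootTree := by
  have hE : ∀ e : rootTree.E, e = .inl 0 := by
    rintro (e | e)
    · exact congrArg Sum.inl (Fin.fin_one_eq_zero e)
    · exact e.elim0
  have hI : ∀ e, rootTree.typ e = .I := fun e => by rw [hE e]; rfl
  have hn : ∀ e c, rootTree.typ e ≠ .of c := fun e c => by rw [hI e]; simp
  have hst : ∀ e e', rootTree.tgt e' ≠ rootTree.src e := fun e e' => by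
    rw [hE e, hE e']
    intro h
    exact one_ne_zero (Sum.inl_injective (show (Sum.inl 1 : Fin 2 ⊕ Fin 0) = Sum.inl 0 from h))
  let r : rootTree.V → ℕ := Sum.elim (fun i : Fin 2 => i.1) (fun _ => 0)
  refine ⟨⟨fun e e' _ => (hE e).trans (hE e').symm, fun e e' _ _ => (hE e).trans (hE e').symm,
    fun e e' _ _ => (hE e').trans (hE e).symm, fun e e' _ => hst e e',
    acyclic_of_height r fun e => ?_, fun e c h => (hn e c h).elim,
    fun e c h => (hn e c h).elim⟩, ⟨.inl 0⟩, ?_⟩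
  · rw [hE e]
    exact Nat.zero_lt_one
  · have h0 : ∀ u : rootTree.V, Relation.EqvGen rootTree.Step (.inl 0) u := by
      rintro (u | u)
      · fin_cases u
        · exact .refl _
        · exact .rel _ _ ⟨.inl 0, rfl, rfl⟩
      · exact u.elim0
    exact fun u v => .trans _ _ _ (.symm _ _ (h0 u)) (h0 v)

/-! ### Paths -/

/-- The edge `h` leads from the target of `g` to its child on side `s`. -/
def IsChild (X : TGraph) (s : Side) (g h : X.E) : Prop :=
  X.src h = X.tgt g ∧ X.typ h = .of s

/-- The sum of `v` over the `s`-children of an edge. -/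
def pull (X : TGraph) (s : Side) (v : X.E → ℤ) (g : X.E) : ℤ :=
  ∑ h, if IsChild X s g h then v h else 0

/-- The sum of `w` over the edges of which an edge is the `s`-child. -/
def push (X : TGraph) (s : Side) (w : X.E → ℤ) (h : X.E) : ℤ :=
  ∑ g, if IsChild X s g h then w g else 0

/-- The number of paths that start with a given edge and continue with `k` edges of type `s`. -/
def desc (X : TGraph) (s : Side) (k : ℕ) : X.E → ℤ := (pull X s)^[k] 1

/-- The number of paths that arrive at a given edge after `k` steps to an `s`-child. -/
def asc (X : TGraph) (s : Side) (k : ℕ) : X.E → ℤ := (push X s)^[k] 1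

theorem desc_zero (X : TGraph) (s : Side) (e : X.E) : desc X s 0 e = 1 := rfl

theorem asc_zero (X : TGraph) (s : Side) (e : X.E) : asc X s 0 e = 1 := rfl

theorem desc_succ (X : TGraph) (s : Side) (k : ℕ) : desc X s (k + 1) = pull X s (desc X s k) :=
  Function.iterate_succ_apply' _ _ _

theorem asc_succ (X : TGraph) (s : Side) (k : ℕ) : asc X s (k + 1) = push X s (asc X s k) :=
  Function.iterate_succ_apply' _ _ _

theorem sum_mul_pull (X : TGraph) (s : Side) (w v : X.E → ℤ) :
    ∑ e, w e * pull X s v e = ∑ e, push X s w e * v e := by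
  simp only [pull, push, Finset.mul_sum, Finset.sum_mul, mul_ite, ite_mul, mul_zero, zero_mul]
  exact Finset.sum_comm

/-- The sequence of edges is a path that always proceeds to the `s`-child. -/
def IsPath (X : TGraph) (s : Side) {n : ℕ} (p : Fin (n + 1) → X.E) : Prop :=
  ∀ i : Fin n, IsChild X s (p i.castSucc) (p i.succ)

theorem isPath_cons {X : TGraph} {s : Side} {n : ℕ} (a : X.E) (q : Fin (n + 1) → X.E) :
    IsPath X s (Fin.cons a q : Fin (n + 2) → X.E) ↔ IsChild X s a (q 0) ∧ IsPath X s q := by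
  simp [IsPath, Fin.forall_fin_succ (n := n)]

theorem sum_cons {E M : Type*} [Fintype E] [AddCommMonoid M] {n : ℕ} (F : (Fin (n + 1) → E) → M) :
    ∑ p, F p = ∑ a, ∑ q : Fin n → E, F (Fin.cons a q) := by
  rw [← Fintype.sum_prod_type', ← (Fin.consEquiv fun _ => E).sum_comp]
  rfl

theorem sum_path_zero {M : Type*} [AddCommGroup M] (X : TGraph) (s : Side) (n : ℕ)
    (F : X.E → M) :
    ∑ p : Fin (n + 1) → X.E, (if IsPath X s p then F (p 0) else 0)
      = ∑ e, desc X s n e • F e := by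
  induction n generalizing F with
  | zero =>
    rw [sum_cons]
    simp [IsPath, desc]
  | succ n ih =>
    rw [sum_cons]
    refine Finset.sum_congr rfl fun a _ => ?_
    rw [desc_succ, pull, Finset.sum_smul]
    simp only [isPath_cons, Fin.cons_zero]
    have := ih (fun e => if IsChild X s a e then F a else 0)
    simp only [smul_ite, smul_zero] at this
    simp only [ite_smul, zero_smul]
    rw [← this]
    refine Finset.sum_congr rfl fun q _ => ?_
    split_ifs <;> simp_all

/-- Paths are counted by splitting them at their edge number `j`. -/
theorem sum_path {M : Type*} [AddCommGroup M] (X : TGraph) (s : Side) (n : ℕ) (j : Fin (n + 1))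
    (F : X.E → M) :
    ∑ p : Fin (n + 1) → X.E, (if IsPath X s p then F (p j) else 0)
      = ∑ e, (asc X s j e * desc X s (n - j) e) • F e := by
  suffices H : ∀ w : X.E → ℤ,
      ∑ p : Fin (n + 1) → X.E, (if IsPath X s p then w (p 0) • F (p j) else 0)
      = ∑ e, (((push X s)^[j] w) e * desc X s (n - j) e) • F e by
    simpa [asc] using H 1
  intro w
  induction n generalizing w with
  | zero =>
    obtain rfl : j = 0 := Fin.fin_one_eq_zero j
    rw [sum_path_zero X s 0 fun e => w e • F e]
    simp [desc_zero]
  | succ n ih =>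
    induction j using Fin.cases with
    | zero =>
      rw [sum_path_zero X s _ fun e => w e • F e]
      refine Finset.sum_congr rfl fun e _ => ?_
      rw [smul_smul, mul_comm]
      rfl
    | succ j =>
      have := ih j (push X s w)
      rw [sum_cons, Finset.sum_comm]
      simp only [Fin.val_succ, Function.iterate_succ_apply, Nat.add_sub_add_right]
      rw [← this]
      refine Finset.sum_congr rfl fun q _ => ?_
      simp only [isPath_cons, Fin.cons_zero, Fin.cons_succ]
      by_cases hq : IsPath X s q
      · simp only [hq, and_true, if_true, push, Finset.sum_smul, ite_smul, zero_smul]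
      · simp [hq]

/-! ### Combs in forests are paths -/

theorem comb_hom_ext {X : TGraph} (hX : IsPRBF X) {n : ℕ} {T : EdgeType} {s : Side}
    {m m' : Hom (comb n T s) X} (h : ∀ i, m.fE (.inl i) = m'.fE (.inl i)) : m = m' := by
  have hE : m.fE = m'.fE := by
    funext e
    rcases e with i | j
    · exact h i
    · refine hX.out_unique _ _ ?_ ?_
      · have h1 : X.src (m.fE (.inr j)) = X.src (m.fE (.inl j.succ)) :=
          (m.src_comm (.inr j)).trans (m.src_comm (.inl j.succ)).symm
        have h2 : X.src (m'.fE (.inr j)) = X.src (m'.fE (.inl j.succ)) :=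
          (m'.src_comm (.inr j)).trans (m'.src_comm (.inl j.succ)).symm
        rw [h1, h2, h]
      · exact (m.typ_comm _).trans (m'.typ_comm _).symm
  refine Hom.ext (funext fun v => ?_) hE
  have hs : ∀ e, m.fV ((comb n T s).src e) = m'.fV ((comb n T s).src e) := fun e => by
    rw [← m.src_comm, ← m'.src_comm, hE]
  have ht : ∀ e, m.fV ((comb n T s).tgt e) = m'.fV ((comb n T s).tgt e) := fun e => by
    rw [← m.tgt_comm, ← m'.tgt_comm, hE]
  rcases v with i | j
  · induction i using Fin.cases with
    | zero => exact hs (.inl 0)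
    | succ i => exact ht (.inl i)
  · exact ht (.inr j)

/-- A morphism from a comb to a forest is injective: heights increase along the path, and an edge is
determined by its target. -/
theorem comb_hom_isMono {X : TGraph} (hX : IsPRBF X) {n : ℕ} {T : EdgeType} {s : Side}
    (m : Hom (comb n T s) X) : m.IsMono := by
  obtain ⟨r, hr⟩ := hX.exists_height
  have hmono : StrictMono fun i : Fin (n + 2) => r (m.fV (.inl i)) := by
    refine Fin.strictMono_iff_lt_succ.2 fun i => ?_
    have h1 : X.src (m.fE (.inl i)) = m.fV (.inl i.castSucc) := m.src_comm _
    have h2 : X.tgt (m.fE (.inl i)) = m.fV (.inl i.succ) := m.tgt_comm _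
    change r (m.fV (.inl i.castSucc)) < r (m.fV (.inl i.succ))
    rw [← h1, ← h2]
    exact hr _
  have hpath : ∀ i i' : Fin (n + 2), m.fV (.inl i) = m.fV (.inl i') → i = i' := fun i i' h =>
    hmono.injective (congrArg r h)
  have hside : ∀ (i : Fin (n + 2)) (j : Fin n), m.fV (.inl i) ≠ m.fV (.inr j) := by
    intro i j h
    have hs : X.src (m.fE (.inr j)) = m.fV (.inl j.succ.castSucc) := m.src_comm _
    have ht : X.tgt (m.fE (.inr j)) = m.fV (.inr j) := m.tgt_comm _
    induction i using Fin.cases with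
    | zero =>
      have h1 := hr (m.fE (.inr j))
      rw [hs, ht, ← h] at h1
      exact absurd (hmono.lt_iff_lt.1 h1) (Fin.not_lt_zero _)
    | succ i =>
      have ht' : X.tgt (m.fE (.inl i)) = m.fV (.inl i.succ) := m.tgt_comm _
      have hs' : X.src (m.fE (.inl i)) = m.fV (.inl i.castSucc) := m.src_comm _
      have heq := hX.in_unique _ _ (ht'.trans (h.trans ht.symm))
      have hij : i = j.succ := by
        rw [← heq, hs'] at hs
        exact Fin.castSucc_injective _ (hpath _ _ hs)
      have h1 : X.typ (m.fE (.inl i)) = .of s := by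
        rw [hij]
        exact (m.typ_comm _).trans (if_neg (t := T) (Fin.succ_ne_zero j))
      have h2 : X.typ (m.fE (.inr j)) = .of s.opp := m.typ_comm _
      rw [heq, h2] at h1
      exact Side.opp_ne s (EdgeType.of.inj h1)
  have hV : Function.Injective m.fV := by
    rintro (i | j) (i' | j') h
    · rw [hpath i i' h]
    · exact (hside _ _ h).elim
    · exact (hside _ _ h.symm).elim
    · have hs : ∀ j, X.src (m.fE (.inr j)) = m.fV (.inl j.succ.castSucc) := fun j => m.src_comm _
      have ht : ∀ j, X.tgt (m.fE (.inr j)) = m.fV (.inr j) := fun j => m.tgt_comm _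
      have heq := hX.in_unique _ _ ((ht j).trans (h.trans (ht j').symm))
      have h1 := hpath _ _ ((hs j).symm.trans ((congrArg X.src heq).trans (hs j')))
      rw [Fin.succ_injective _ (Fin.castSucc_injective _ h1)]
  refine ⟨hV, fun a b h => ?_⟩
  have h1 : (comb n T s).tgt a = (comb n T s).tgt b := by
    apply hV
    rw [← m.tgt_comm, ← m.tgt_comm, h]
  rcases a with i | j <;> rcases b with i' | j'
  · rw [Fin.succ_injective _ (Sum.inl_injective h1)]
  · exact (Sum.inl_ne_inr h1).elim
  · exact (Sum.inr_ne_inl h1).elim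
  · rw [Sum.inr_injective h1]

theorem comb_hom_isPath {X : TGraph} {n : ℕ} {T : EdgeType} {s : Side}
    (m : Hom (comb n T s) X) : IsPath X s fun i => m.fE (.inl i) := fun i =>
  ⟨(m.src_comm (.inl i.succ)).trans (m.tgt_comm (.inl i.castSucc)).symm,
    (m.typ_comm _).trans (if_neg (t := T) (Fin.succ_ne_zero i))⟩

theorem exists_comb_hom {X : TGraph} (hX : IsPRBF X) {n : ℕ} {s : Side} {p : Fin (n + 1) → X.E}
    (hp : IsPath X s p) :
    ∃ m : Hom (comb n (X.typ (p 0)) s) X, ∀ i, m.fE (.inl i) = p i := by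
  have hsib : ∀ j : Fin n, ∃ e, X.src e = X.src (p j.succ) ∧ X.typ e = .of s.opp := fun j =>
    hX.sibling _ _ (hp j).2
  choose q hq1 hq2 using hsib
  let fP : Fin (n + 2) → X.V := Fin.cases (X.src (p 0)) fun i => X.tgt (p i)
  have hP : ∀ i, X.src (p i) = fP i.castSucc := by
    intro i
    rcases n with _ | n
    · rw [Fin.fin_one_eq_zero i]; rfl
    · induction i using Fin.cases with
      | zero => rfl
      | succ i => exact (hp i).1
  refine ⟨⟨Sum.elim fP fun j => X.tgt (q j), Sum.elim p q, ?_, ?_, ?_⟩, fun _ => rfl⟩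
  · rintro (i | j)
    · exact hP i
    · exact (hq1 j).trans (hP _)
  · rintro (i | j) <;> rfl
  · rintro (i | j)
    · change X.typ (p i) = if i = 0 then X.typ (p 0) else .of s
      split_ifs with h
      · rw [h]
      · obtain ⟨k, rfl⟩ := Fin.exists_succ_eq.2 h
        exact (hp k).2
    · exact hq2 j

/-- In a forest, the occurrences of combs with `n` inner nodes are the paths with `n + 1` edges: the
remaining edges and vertices of a comb exist, are unique, and are distinct. -/
theorem comb_path_bijective {X : TGraph} (hX : IsPRBF X) (n : ℕ) (s : Side) :
    Function.Bijective
      (fun x : Σ T, {m : Hom (comb n T s) X // m.IsMono} =>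
        (⟨fun i => x.2.1.fE (.inl i), comb_hom_isPath x.2.1⟩ :
          {p : Fin (n + 1) → X.E // IsPath X s p})) := by
  constructor
  · rintro ⟨T, m, hm⟩ ⟨T', m', hm'⟩ h
    have h : ∀ i, m.fE (.inl i) = m'.fE (.inl i) := congrFun (congrArg Subtype.val h)
    have h1 : X.typ (m.fE (.inl 0)) = T := m.typ_comm _
    have h2 : X.typ (m'.fE (.inl 0)) = T' := m'.typ_comm _
    obtain rfl : T = T' := by rw [← h1, ← h2, h]
    obtain rfl := comb_hom_ext hX h
    rfl
  · rintro ⟨p, hp⟩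
    obtain ⟨m, hm⟩ := exists_comb_hom hX hp
    exact ⟨⟨_, m, comb_hom_isMono hX m⟩, Subtype.ext (funext hm)⟩

theorem combCount_eq_card {X : TGraph} (hX : IsPRBF X) (n : ℕ) (s : Side) :
    combCount n s X = Nat.card {p : Fin (n + 1) → X.E // IsPath X s p} := by
  have h (T : EdgeType) : Finite {m : Hom (comb n T s) X // m.IsMono} := inferInstance
  rw [combCount, ← Nat.card_sigma,
    Nat.card_congr (Equiv.ofBijective _ (comb_path_bijective hX n s))]

/-- Every edge `e` is in position `j` of `asc j e * desc (n - j) e` paths, whatever `j` is chosen. -/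
theorem combCount_eq_sum {X : TGraph} (hX : IsPRBF X) (n : ℕ) (s : Side) (j : Fin (n + 1)) :
    (combCount n s X : ℤ) = ∑ e, asc X s j e * desc X s (n - j) e := by
  have := sum_path X s n j fun _ => (1 : ℤ)
  simp only [smul_eq_mul, mul_one] at this
  rw [← this, combCount_eq_card hX, Nat.card_eq_fintype_card, Fintype.card_subtype]
  simp

theorem insertComb_ket {X : TGraph} (hX : IsPRBF X) (n : ℕ) (s : Side) (j : Fin (n + 1))
    (c : Side) :
    insertComb n s j c (ket X)
      = ∑ e, (asc X s j e * desc X s (n - j) e) • ket (insertLeaf X e c) := by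
  let F : X.E → Chat := fun e => ket (insertLeaf X e c)
  let η : ∀ T, Match (insertRule (comb n T s) (.inl j) c) X ≃ {m : Hom (comb n T s) X // m.IsMono} :=
    fun T => Equiv.subtypeEquivRight fun m => ⟨fun h => h.1, fun h => ⟨h, hX⟩⟩
  have (T : EdgeType) : Fintype {m : Hom (comb n T s) X // m.IsMono} := Fintype.ofFinite _
  rw [← sum_path X s n j F, insertComb, LinearMap.sum_apply]
  calc _ = ∑ T, ∑ m : {m : Hom (comb n T s) X // m.IsMono}, F (m.1.fE (.inl j)) := by
        refine Finset.sum_congr rfl fun T _ => ?_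
        exact (rho_insertRule_ket _ _ _ _).trans (Fintype.sum_equiv (η T) _ _ fun _ => rfl)
    _ = ∑ x : Σ T, {m : Hom (comb n T s) X // m.IsMono}, F (x.2.1.fE (.inl j)) :=
        (Fintype.sum_sigma fun x : Σ T, {m : Hom (comb n T s) X // m.IsMono} =>
          F (x.2.1.fE (.inl j))).symm
    _ = ∑ p : {p : Fin (n + 1) → X.E // IsPath X s p}, F (p.1 j) :=
        Fintype.sum_bijective _ (comb_path_bijective hX n s) _ _ fun _ => rfl
    _ = _ := by
        rw [← Finset.sum_filter]
        exact (Finset.sum_subtype (Finset.univ.filter fun p : Fin (n + 1) → X.E => IsPath X s p)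
          (fun p => Finset.mem_filter_univ p) fun p => F (p j)).symm

/-! ### Depth and height of an edge in its path -/

theorem IsChild.unique {X : TGraph} (hX : IsPRBF X) {s : Side} {g h h' : X.E}
    (H : IsChild X s g h) (H' : IsChild X s g h') : h = h' :=
  hX.out_unique _ _ (H.1.trans H'.1.symm) (H.2.trans H'.2.symm)

theorem IsChild.parent_unique {X : TGraph} (hX : IsPRBF X) {s : Side} {g g' h : X.E}
    (H : IsChild X s g h) (H' : IsChild X s g' h) : g = g' :=
  hX.in_unique _ _ (H.1.symm.trans H'.1)

theorem sum_ite_eq_zero_or {E : Type*} [Fintype E] {P : E → Prop} (hP : ∀ a b, P a → P b → a = b)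
    (v : E → ℤ) :
    ∑ e, (if P e then v e else 0) = 0 ∨ ∃ e, ∑ e, (if P e then v e else 0) = v e := by
  by_cases h : ∃ e, P e
  · obtain ⟨e, he⟩ := h
    refine .inr ⟨e, ?_⟩
    rw [Finset.sum_eq_single e (fun b _ hb => if_neg fun hPb => hb (hP b e hPb he)) (by simp),
      if_pos he]
  · left
    exact Finset.sum_eq_zero fun e _ => if_neg fun he => h ⟨e, he⟩

theorem desc_eq_zero_or_one {X : TGraph} (hX : IsPRBF X) (s : Side) (k : ℕ) (e : X.E) :
    desc X s k e = 0 ∨ desc X s k e = 1 := by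
  induction k generalizing e with
  | zero => exact .inr rfl
  | succ k ih =>
    rw [desc_succ, pull]
    rcases sum_ite_eq_zero_or (P := fun h => IsChild X s e h) (fun _ _ => IsChild.unique hX)
      (desc X s k) with h | ⟨g, h⟩
    · exact .inl h
    · rw [h]; exact ih g

theorem asc_eq_zero_or_one {X : TGraph} (hX : IsPRBF X) (s : Side) (k : ℕ) (e : X.E) :
    asc X s k e = 0 ∨ asc X s k e = 1 := by
  induction k generalizing e with
  | zero => exact .inr rfl
  | succ k ih =>
    rw [asc_succ, push]
    rcases sum_ite_eq_zero_or (P := fun g => IsChild X s g e) (fun _ _ => IsChild.parent_unique hX)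
      (asc X s k) with h | ⟨g, h⟩
    · exact .inl h
    · rw [h]; exact ih g

theorem desc_succ_le {X : TGraph} (hX : IsPRBF X) (s : Side) (k : ℕ) (e : X.E) :
    desc X s (k + 1) e ≤ desc X s k e := by
  induction k generalizing e with
  | zero =>
    rw [desc_zero]
    rcases desc_eq_zero_or_one hX s (0 + 1) e with h | h <;> simp [h]
  | succ k ih =>
    rw [desc_succ X s (k + 1)]
    conv_rhs => rw [desc_succ X s k]
    refine Finset.sum_le_sum fun h _ => ?_
    split_ifs with H
    · exact ih h
    · rfl

theorem asc_succ_le {X : TGraph} (hX : IsPRBF X) (s : Side) (k : ℕ) (e : X.E) :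
    asc X s (k + 1) e ≤ asc X s k e := by
  induction k generalizing e with
  | zero =>
    rw [asc_zero]
    rcases asc_eq_zero_or_one hX s (0 + 1) e with h | h <;> simp [h]
  | succ k ih =>
    rw [asc_succ X s (k + 1)]
    conv_rhs => rw [asc_succ X s k]
    refine Finset.sum_le_sum fun h _ => ?_
    split_ifs with H
    · exact ih h
    · rfl

/-! ### The change of the comb counts under insertion -/

section Change

variable {X : TGraph} {f : X.E} {c : Side} {s : Side}

theorem pull_insertLeaf_leafE (v : (insertLeaf X f c).E → ℤ) :
    pull (insertLeaf X f c) s v leafE = 0 := by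
  refine Finset.sum_eq_zero fun h _ => if_neg fun H => ?_
  have H := H.1
  rcases insertLeaf_edge_cases' h with ⟨e, rfl⟩ | rfl | rfl <;> simp at H

theorem pull_insertLeaf_downE (v : (insertLeaf X f c).E → ℤ) :
    pull (insertLeaf X f c) s v downE = pull X s (fun e => v (liftE f c e)) f := by
  have h1 : ∀ h, IsChild (insertLeaf X f c) s downE (liftE f c h) ↔ IsChild X s f h := by
    simp [IsChild]
  have h2 : ¬ IsChild (insertLeaf X f c) s downE leafE := by simp [IsChild]
  have h3 : ¬ IsChild (insertLeaf X f c) s downE downE := by simp [IsChild]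
  simp only [pull, sum_insertLeaf, h1, h2, h3, if_false, add_zero]

theorem pull_insertLeaf_liftE_of_ne (v : (insertLeaf X f c).E → ℤ) {e : X.E} (he : e ≠ f) :
    pull (insertLeaf X f c) s v (liftE f c e) = pull X s (fun e => v (liftE f c e)) e := by
  have h1 : ∀ h, IsChild (insertLeaf X f c) s (liftE f c e) (liftE f c h) ↔ IsChild X s e h := by
    simp [IsChild, liftE_of_ne he]
  have h2 : ¬ IsChild (insertLeaf X f c) s (liftE f c e) leafE := by simp [IsChild, liftE_of_ne he]
  have h3 : ¬ IsChild (insertLeaf X f c) s (liftE f c e) downE := by simp [IsChild, liftE_of_ne he]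
  simp only [pull, sum_insertLeaf, h1, h2, h3, if_false, add_zero]

theorem pull_insertLeaf_upE (v : (insertLeaf X f c).E → ℤ) :
    pull (insertLeaf X f c) s v upE = if c = s then v leafE else v downE := by
  have : c.opp = s ↔ c ≠ s := by cases c <;> cases s <;> simp [Side.opp]
  simp only [pull, sum_insertLeaf, IsChild, tgt_upE, src_liftE, oldV_ne_nodeV, false_and, if_false,
    Finset.sum_const_zero, src_leafE, src_downE, typ_leafE, typ_downE, EdgeType.of.injEq, true_and,
    this, zero_add]
  split_ifs <;> simp_all

/-- The change of `desc` at the edge that takes the place of `e`. -/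
def descDiff (X : TGraph) (s : Side) (f : X.E) (c : Side) (k : ℕ) (e : X.E) : ℤ :=
  desc (insertLeaf X f c) s k (liftE f c e) - desc X s k e

theorem descDiff_succ_of_ne (k : ℕ) {e : X.E} (he : e ≠ f) :
    descDiff X s f c (k + 1) e = pull X s (descDiff X s f c k) e := by
  rw [descDiff, desc_succ, desc_succ, pull_insertLeaf_liftE_of_ne _ he]
  simp only [pull, ← Finset.sum_sub_distrib]
  refine Finset.sum_congr rfl fun h _ => ?_
  split_ifs <;> simp [descDiff]

/-- An insertion does not affect the part of the tree below it. -/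
theorem descDiff_eq_zero {r : X.V → ℕ} (hr : ∀ e, r (X.src e) < r (X.tgt e)) (k : ℕ) {e : X.E}
    (he : r (X.tgt f) < r (X.tgt e)) : descDiff X s f c k e = 0 := by
  induction k generalizing e with
  | zero => simp [descDiff, desc_zero]
  | succ k ih =>
    rw [descDiff_succ_of_ne k fun h => by simp [h] at he]
    refine Finset.sum_eq_zero fun h _ => ?_
    split_ifs with H
    · refine ih (he.trans ?_)
      rw [← H.1]
      exact hr h
    · rfl

theorem pull_descDiff_self (hX : IsPRBF X) (k : ℕ) :
    pull X s (descDiff X s f c k) f = 0 := by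
  obtain ⟨r, hr⟩ := hX.exists_height
  refine Finset.sum_eq_zero fun h _ => ?_
  split_ifs with H
  · refine descDiff_eq_zero hr k ?_
    rw [← H.1]
    exact hr h
  · rfl

theorem desc_insertLeaf_leafE (k : ℕ) :
    desc (insertLeaf X f c) s k leafE = if k = 0 then 1 else 0 := by
  rcases k with _ | k
  · rfl
  · rw [desc_succ, pull_insertLeaf_leafE]; rfl

theorem desc_insertLeaf_downE (hX : IsPRBF X) (k : ℕ) :
    desc (insertLeaf X f c) s k downE = desc X s k f := by
  rcases k with _ | k
  · rfl
  · rw [desc_succ, desc_succ, pull_insertLeaf_downE, ← sub_eq_zero,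
      ← pull_descDiff_self (s := s) (f := f) (c := c) hX k]
    simp only [pull, ← Finset.sum_sub_distrib]
    refine Finset.sum_congr rfl fun h _ => ?_
    split_ifs <;> simp [descDiff]

theorem descDiff_zero (e : X.E) : descDiff X s f c 0 e = 0 := sub_self _

/-- A leaf on side `s` ends the path that arrives at `f`; a leaf on the other side lengthens it. -/
theorem descDiff_succ_self (hX : IsPRBF X) (k : ℕ) :
    descDiff X s f c (k + 1) f
      = (if c = s then (if k = 0 then 1 else 0) else desc X s k f) - desc X s (k + 1) f := by
  rw [descDiff, liftE_self, desc_succ (insertLeaf X f c), pull_insertLeaf_upE,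
    desc_insertLeaf_leafE, desc_insertLeaf_downE hX]

/-- Apart from the change at `f` itself, the changes are those at the `s`-children, one step
shorter. -/
theorem sum_mul_descDiff_succ (hX : IsPRBF X) (w : X.E → ℤ) (k : ℕ) :
    ∑ e, w e * descDiff X s f c (k + 1) e
      = w f * descDiff X s f c (k + 1) f + ∑ e, push X s w e * descDiff X s f c k e := by
  rw [← sum_mul_pull, ← Finset.add_sum_erase _ _ (Finset.mem_univ f),
    ← Finset.add_sum_erase _ (fun e => w e * pull X s _ e) (Finset.mem_univ f),
    pull_descDiff_self hX, mul_zero, zero_add]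
  congr 1
  refine Finset.sum_congr rfl fun e he => ?_
  rw [descDiff_succ_of_ne k (Finset.ne_of_mem_erase he)]

theorem combCount_insertLeaf (hX : IsPRBF X) (f : X.E) (c s : Side) (k : ℕ) :
    (combCount k s (insertLeaf X f c) : ℤ)
      = combCount k s X + ∑ e, asc X s 0 e * descDiff X s f c k e
        + (if k = 0 then 1 else 0) + desc X s k f := by
  rw [combCount_eq_sum (hX.insertLeaf f c) k s 0, combCount_eq_sum hX k s 0, sum_insertLeaf]
  simp only [Fin.val_zero, asc_zero, one_mul, tsub_zero, desc_insertLeaf_leafE,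
    desc_insertLeaf_downE hX, descDiff, Finset.sum_sub_distrib]
  ring

/-- The increment of the number of combs with two inner nodes when a leaf is inserted at `f` on
side `c`. -/
def delta2 (X : TGraph) (s : Side) (f : X.E) (c : Side) : ℤ :=
  if c = s then asc X s 1 f - asc X s 1 f * desc X s 1 f
  else desc X s 1 f + asc X s 1 f - asc X s 1 f * desc X s 1 f

/-- The increment of the number of combs with three inner nodes when a leaf is inserted at `f` on
side `c`. -/
def delta3 (X : TGraph) (s : Side) (f : X.E) (c : Side) : ℤ :=
  if c = s then asc X s 2 f - asc X s 2 f * desc X s 1 f - asc X s 1 f * desc X s 2 f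
  else desc X s 2 f + asc X s 1 f * desc X s 1 f + asc X s 2 f
    - asc X s 1 f * desc X s 2 f - asc X s 2 f * desc X s 1 f

theorem combCount_zero_insertLeaf (hX : IsPRBF X) (f : X.E) (c s : Side) :
    (combCount 0 s (insertLeaf X f c) : ℤ) = combCount 0 s X + 2 := by
  rw [combCount_insertLeaf hX]
  simp [descDiff_zero, desc_zero]
  ring

theorem combCount_one_insertLeaf (hX : IsPRBF X) (f : X.E) (c s : Side) :
    (combCount 1 s (insertLeaf X f c) : ℤ) = combCount 1 s X + 1 := by
  rw [combCount_insertLeaf hX, sum_mul_descDiff_succ hX, descDiff_succ_self hX]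
  simp only [descDiff_zero, mul_zero, Finset.sum_const_zero, asc_zero, desc_zero]
  split_ifs <;> simp_all <;> ring

theorem combCount_two_insertLeaf (hX : IsPRBF X) (f : X.E) (c s : Side) :
    (combCount 2 s (insertLeaf X f c) : ℤ) = combCount 2 s X + delta2 X s f c := by
  rw [combCount_insertLeaf hX, sum_mul_descDiff_succ hX, sum_mul_descDiff_succ hX,
    ← asc_succ X s 0, descDiff_succ_self hX, descDiff_succ_self hX]
  simp only [descDiff_zero, mul_zero, Finset.sum_const_zero, asc_zero, desc_zero, delta2]
  split_ifs <;> simp_all <;> ring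

theorem combCount_three_insertLeaf (hX : IsPRBF X) (f : X.E) (c s : Side) :
    (combCount 3 s (insertLeaf X f c) : ℤ) = combCount 3 s X + delta3 X s f c := by
  rw [combCount_insertLeaf hX, sum_mul_descDiff_succ hX, sum_mul_descDiff_succ hX,
    sum_mul_descDiff_succ hX, ← asc_succ X s 0, ← asc_succ X s 1, descDiff_succ_self hX,
    descDiff_succ_self hX, descDiff_succ_self hX]
  simp only [descDiff_zero, mul_zero, Finset.sum_const_zero, asc_zero, desc_zero, delta3]
  split_ifs <;> simp_all <;> ring

end Change

theorem sum_side {M : Type*} [AddCommMonoid M] (s : Side) (F : Side → M) :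
    ∑ c, F c = F s + F s.opp := by
  have h : ∑ c, F c = F .L + F .R := Finset.sum_pair (by simp)
  cases s
  · exact h
  · exact h.trans (add_comm _ _)

theorem Side.eq_or_eq_opp (s c : Side) : c = s ∨ c = s.opp := by
  cases s <;> cases c <;> simp [Side.opp]

theorem desc_cases {X : TGraph} (hX : IsPRBF X) (s : Side) (e : X.E) :
    (desc X s 1 e = 0 ∧ desc X s 2 e = 0) ∨ (desc X s 1 e = 1 ∧ desc X s 2 e = 0) ∨
      (desc X s 1 e = 1 ∧ desc X s 2 e = 1) := by
  have h1 := desc_eq_zero_or_one hX s 1 e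
  have h2 := desc_eq_zero_or_one hX s 2 e
  have h3 := desc_succ_le hX s 1 e
  norm_num at h3
  omega

theorem asc_cases {X : TGraph} (hX : IsPRBF X) (s : Side) (e : X.E) :
    (asc X s 1 e = 0 ∧ asc X s 2 e = 0) ∨ (asc X s 1 e = 1 ∧ asc X s 2 e = 0) ∨
      (asc X s 1 e = 1 ∧ asc X s 2 e = 1) := by
  have h1 := asc_eq_zero_or_one hX s 1 e
  have h2 := asc_eq_zero_or_one hX s 2 e
  have h3 := asc_succ_le hX s 1 e
  norm_num at h3
  omega

/-! ### The side is irrelevant for combs with at most one inner node -/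

theorem desc_one_side {X : TGraph} (hX : IsPRBF X) (s s' : Side) (e : X.E) :
    desc X s 1 e = desc X s' 1 e := by
  have key : ∀ s, desc X s 1 e = if ∃ h, IsChild X s e h then 1 else 0 := by
    intro s
    rw [desc_succ X s 0, pull]
    simp only [desc_zero]
    split_ifs with h
    · obtain ⟨h, hh⟩ := h
      rw [Finset.sum_eq_single h (fun b _ hb => if_neg fun hPb => hb (hPb.unique hX hh)) (by simp),
        if_pos hh]
    · exact Finset.sum_eq_zero fun h' _ => if_neg fun hh => h ⟨h', hh⟩
  have hopp : ∀ s, (∃ h, IsChild X s e h) → ∃ h, IsChild X s.opp e h := by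
    rintro s ⟨h, h1, h2⟩
    obtain ⟨h', h3, h4⟩ := hX.sibling h s h2
    exact ⟨h', h3.trans h1, h4⟩
  rcases Side.eq_or_eq_opp s s' with rfl | rfl
  · rfl
  · rw [key, key]
    refine if_congr ⟨hopp s, fun h => ?_⟩ rfl rfl
    simpa using hopp _ h

theorem combCount_zero_side {X : TGraph} (hX : IsPRBF X) (s s' : Side) :
    combCount 0 s X = combCount 0 s' X := by
  have h : (combCount 0 s X : ℤ) = combCount 0 s' X := by
    rw [combCount_eq_sum hX 0 s 0, combCount_eq_sum hX 0 s' 0]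
    rfl
  exact_mod_cast h

theorem combCount_one_side {X : TGraph} (hX : IsPRBF X) (s s' : Side) :
    combCount 1 s X = combCount 1 s' X := by
  have h : (combCount 1 s X : ℤ) = combCount 1 s' X := by
    rw [combCount_eq_sum hX 1 s 0, combCount_eq_sum hX 1 s' 0]
    simp [asc_zero, desc_one_side hX s s']
  exact_mod_cast h

theorem counts_zero {X : TGraph} (hX : IsPRBF X) (s : Side) : counts s X 0 = combCount 0 s X :=
  combCount_zero_side hX _ _

theorem counts_one {X : TGraph} (hX : IsPRBF X) (s : Side) : counts s X 1 = combCount 1 s X :=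
  combCount_one_side hX _ _

theorem counts_two (X : TGraph) (s : Side) : counts s X 2 = combCount 2 s X := rfl

theorem counts_three (X : TGraph) (s : Side) : counts s X 3 = combCount 3 s X := rfl

/-- The increments of the four pattern counts when a leaf is inserted at `f` on side `c`. -/
def delta (X : TGraph) (s : Side) (f : X.E) (c : Side) : Fin 4 → ℤ :=
  ![2, 1, delta2 X s f c, delta3 X s f c]

theorem counts_insertLeaf {X : TGraph} (hX : IsPRBF X) (s : Side) (f : X.E) (c : Side)
    (i : Fin 4) : (counts s (insertLeaf X f c) i : ℤ) = counts s X i + delta X s f c i := by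
  fin_cases i
  · exact combCount_zero_insertLeaf hX f c .L
  · exact combCount_one_insertLeaf hX f c .L
  · exact combCount_two_insertLeaf hX f c s
  · exact combCount_three_insertLeaf hX f c s

/-! ### Operators that insert leaves -/

/-- The operator `B` maps `|X⟩` to the combination, with coefficients `b f c`, of the results of
inserting a leaf at the edge `f` on side `c`. -/
def HasRep (X : TGraph) (B : Op) (b : X.E → Side → ℝ) : Prop :=
  B (ket X) = ∑ f, ∑ c, b f c • ket (insertLeaf X f c)

section Rep

variable {X : TGraph} {A B : Op} {a b : X.E → Side → ℝ}

theorem HasRep.add (hA : HasRep X A a) (hB : HasRep X B b) :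
    HasRep X (A + B) fun f c => a f c + b f c := by
  simp only [HasRep, LinearMap.add_apply, add_smul, Finset.sum_add_distrib] at *
  rw [hA, hB]

theorem HasRep.sub (hA : HasRep X A a) (hB : HasRep X B b) :
    HasRep X (A - B) fun f c => a f c - b f c := by
  simp only [HasRep, LinearMap.sub_apply, sub_smul, Finset.sum_sub_distrib] at *
  rw [hA, hB]

theorem HasRep.smul (r : ℝ) (hA : HasRep X A a) : HasRep X (r • A) fun f c => r * a f c := by
  simp only [HasRep, LinearMap.smul_apply, mul_smul, ← Finset.smul_sum] at *
  rw [hA]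

theorem HasRep.neg (hA : HasRep X A a) : HasRep X (-A) fun f c => -a f c := by
  simp only [HasRep, LinearMap.neg_apply, neg_smul, Finset.sum_neg_distrib] at *
  rw [hA]

theorem HasRep.zero (X : TGraph) : HasRep X 0 fun _ _ => 0 := by
  simp [HasRep]

theorem HasRep.ext (hA : HasRep X A a) (hB : HasRep X B b) (h : ∀ f c, a f c = b f c) :
    A (ket X) = B (ket X) := by
  rw [hA, hB]
  simp only [h]

theorem HasRep.congr (hA : HasRep X A a) (h : ∀ f c, a f c = b f c) : HasRep X A b := by
  simpa only [HasRep, h] using hA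

theorem HasRep.bra (hA : HasRep X A a) : bra (A (ket X)) = ∑ f, ∑ c, a f c := by
  rw [hA]
  simp only [map_sum, map_smul, bra_ket, smul_eq_mul, mul_one]

/-- The commutator with a diagonal operator multiplies the coefficients by the increments of the
eigenvalue. -/
theorem HasRep.lie (v : TGraph → ℝ) (hv : ∀ Y, A (ket Y) = v Y • ket Y) (hB : HasRep X B b) :
    HasRep X ⁅A, B⁆ fun f c => (v (insertLeaf X f c) - v X) * b f c := by
  simp only [HasRep, Ring.lie_def, LinearMap.sub_apply, Module.End.mul_apply, map_smul, hv X,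
    sub_mul, sub_smul, Finset.sum_sub_distrib] at *
  rw [hB]
  simp only [map_sum, map_smul, hv, Finset.smul_sum, smul_smul, mul_comm]

theorem HasRep.lie_obs (hX : IsPRBF X) (s : Side) (i : Fin 4) (hB : HasRep X B b) :
    HasRep X ⁅obs s i, B⁆ fun f c => (delta X s f c i : ℝ) * b f c := by
  have h := hB.lie (fun Y => (counts s Y i : ℝ)) (obs_ket s i)
  have hd : ∀ f c, (counts s (insertLeaf X f c) i : ℝ) - counts s X i = delta X s f c i := by
    intro f c
    rw [sub_eq_iff_eq_add']
    exact_mod_cast counts_insertLeaf hX s f c i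
  simpa only [hd] using h

theorem HasRep.lie_OE (hX : IsPRBF X) (hB : HasRep X B b) :
    HasRep X ⁅OE, B⁆ fun f c => 2 * b f c :=
  (hB.lie_obs hX .L 0).congr fun f c => by simp [delta]

theorem HasRep.lie_OP1 (hX : IsPRBF X) (hB : HasRep X B b) : HasRep X ⁅OP1, B⁆ b :=
  (hB.lie_obs hX .L 1).congr fun f c => by simp [delta]

theorem HasRep.lie_OP2 (hX : IsPRBF X) (s : Side) (hB : HasRep X B b) :
    HasRep X ⁅OP2 s, B⁆ fun f c => (delta2 X s f c : ℝ) * b f c :=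
  hB.lie_obs hX s 2

theorem HasRep.lie_OP3 (hX : IsPRBF X) (s : Side) (hB : HasRep X B b) :
    HasRep X ⁅OP3 s, B⁆ fun f c => (delta3 X s f c : ℝ) * b f c :=
  hB.lie_obs hX s 3

theorem hasRep_insertComb (hX : IsPRBF X) (n : ℕ) (s : Side) (j : Fin (n + 1)) (c : Side) :
    HasRep X (insertComb n s j c) fun f c' =>
      if c' = c then (asc X s j f : ℝ) * desc X s (n - j) f else 0 := by
  rw [HasRep, insertComb_ket hX]
  refine Finset.sum_congr rfl fun f _ => ?_
  simp only [ite_smul, zero_smul, Finset.sum_ite_eq', Finset.mem_univ, if_true]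
  rw [← Int.cast_mul, Int.cast_smul_eq_zsmul]

theorem hasRep_G (hX : IsPRBF X) : HasRep X G fun _ _ => 1 := by
  have h := (hasRep_insertComb hX 0 .L 0 .L).add (hasRep_insertComb hX 0 .L 0 .R)
  refine h.congr fun f c => ?_
  cases c <;> simp [asc_zero, desc_zero]

end Rep

/-! ### The distribution of the increments -/

/-- The possible increments of the numbers of combs with two and three inner nodes are `(0, 0)`,
`(1, 0)`, `(1, 1)` and `(0, -1)`, and how often each of them occurs among all insertions is a linear
function of the pattern counts. -/
theorem sum_delta {M : Type*} [AddCommGroup M] {X : TGraph} (hX : IsPRBF X) (s : Side)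
    (F : ℤ → ℤ → M) :
    ∑ f, ∑ c, F (delta2 X s f c) (delta3 X s f c)
      = (2 * counts s X 0 - 3 * counts s X 1 + 2 * counts s X 2 - counts s X 3 : ℤ) • F 0 0
        + (3 * counts s X 1 - 6 * counts s X 2 + 3 * counts s X 3 : ℤ) • F 1 0
        + (4 * counts s X 2 - 3 * counts s X 3 : ℤ) • F 1 1
        + (counts s X 3 : ℤ) • F 0 (-1) := by
  -- The coefficients are written in terms of `asc j f * desc k f`, whose sums over `f` are counts.
  have key : ∀ f, ∑ c, F (delta2 X s f c) (delta3 X s f c)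
      = (2 - (2 * asc X s 1 f + desc X s 1 f) + 2 * (asc X s 1 f * desc X s 1 f)
          - asc X s 1 f * desc X s 2 f) • F 0 0
        + ((2 * asc X s 1 f + desc X s 1 f)
          - (3 * (asc X s 1 f * desc X s 1 f) + 2 * asc X s 2 f + desc X s 2 f)
          + (2 * (asc X s 2 f * desc X s 1 f) + asc X s 1 f * desc X s 2 f)) • F 1 0
        + ((2 * asc X s 2 f + desc X s 2 f + asc X s 1 f * desc X s 1 f)
          - (asc X s 1 f * desc X s 2 f + 2 * (asc X s 2 f * desc X s 1 f))) • F 1 1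
        + (asc X s 1 f * desc X s 2 f) • F 0 (-1) := by
    intro f
    rw [sum_side s]
    rcases asc_cases hX s f with ⟨h1, h2⟩ | ⟨h1, h2⟩ | ⟨h1, h2⟩ <;>
    rcases desc_cases hX s f with ⟨d1, d2⟩ | ⟨d1, d2⟩ | ⟨d1, d2⟩ <;>
    simp [delta2, delta3, h1, h2, d1, d2, two_zsmul, add_comm]
  have e0 : (combCount 0 s X : ℤ) = ∑ _e : X.E, 1 := by
    simpa [asc_zero, desc_zero] using combCount_eq_sum hX 0 s 0
  have e10 : (combCount 1 s X : ℤ) = ∑ e, desc X s 1 e := by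
    simpa [asc_zero] using combCount_eq_sum hX 1 s 0
  have e11 : (combCount 1 s X : ℤ) = ∑ e, asc X s 1 e := by
    simpa [desc_zero] using combCount_eq_sum hX 1 s 1
  have e20 : (combCount 2 s X : ℤ) = ∑ e, desc X s 2 e := by
    simpa [asc_zero] using combCount_eq_sum hX 2 s 0
  have e21 : (combCount 2 s X : ℤ) = ∑ e, asc X s 1 e * desc X s 1 e := by
    simpa using combCount_eq_sum hX 2 s 1
  have e22 : (combCount 2 s X : ℤ) = ∑ e, asc X s 2 e := by
    simpa [desc_zero] using combCount_eq_sum hX 2 s 2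
  have e31 : (combCount 3 s X : ℤ) = ∑ e, asc X s 1 e * desc X s 2 e := by
    simpa using combCount_eq_sum hX 3 s 1
  have e32 : (combCount 3 s X : ℤ) = ∑ e, asc X s 2 e * desc X s 1 e := by
    simpa using combCount_eq_sum hX 3 s 2
  have two : ∑ _e : X.E, (2 : ℤ) = 2 * ∑ _e : X.E, 1 := by rw [Finset.mul_sum]; rfl
  simp only [key, Finset.sum_add_distrib, ← Finset.sum_smul, Finset.sum_sub_distrib,
    ← Finset.mul_sum]
  rw [counts_zero hX, counts_one hX, counts_two, counts_three, two, ← e0, ← e21, ← e31, ← e22,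
    ← e20, ← e11, ← e10, ← e32]
  module

/-! ### Commutators -/

theorem lie_OE_G : EqOnTrees ⁅OE, G⁆ ((2 : ℝ) • G) := fun _ hX =>
  ((hasRep_G hX.forest).lie_OE hX.forest).ext ((hasRep_G hX.forest).smul 2) fun _ _ => rfl

theorem lie_OP1_G : EqOnTrees ⁅OP1, G⁆ G := fun _ hX =>
  ((hasRep_G hX.forest).lie_OP1 hX.forest).ext (hasRep_G hX.forest) fun _ _ => rfl

theorem lie_OP2_G (s : Side) : EqOnTrees ⁅OP2 s, G⁆
    (insertComb 1 s 0 s.opp + insertComb 1 s 1 s + insertComb 1 s 1 s.opp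
      - insertComb 2 s 1 s - insertComb 2 s 1 s.opp) := by
  intro X hX
  have hX := hX.forest
  refine ((hasRep_G hX).lie_OP2 hX s).ext
    (((((hasRep_insertComb hX 1 s 0 s.opp).add (hasRep_insertComb hX 1 s 1 s)).add
      (hasRep_insertComb hX 1 s 1 s.opp)).sub (hasRep_insertComb hX 2 s 1 s)).sub
      (hasRep_insertComb hX 2 s 1 s.opp)) fun f c => ?_
  rcases Side.eq_or_eq_opp s c with rfl | rfl <;> simp [delta2, asc_zero, desc_zero]

theorem lie_OP3_G (s : Side) : EqOnTrees ⁅OP3 s, G⁆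
    (insertComb 2 s 0 s.opp + insertComb 2 s 1 s.opp + insertComb 2 s 2 s
      + insertComb 2 s 2 s.opp
      - insertComb 3 s 1 s.opp - insertComb 3 s 2 s - insertComb 3 s 2 s.opp - RP3' s) := by
  intro X hX
  have hX := hX.forest
  refine ((hasRep_G hX).lie_OP3 hX s).ext
    ((((((((hasRep_insertComb hX 2 s 0 s.opp).add (hasRep_insertComb hX 2 s 1 s.opp)).add
      (hasRep_insertComb hX 2 s 2 s)).add (hasRep_insertComb hX 2 s 2 s.opp)).sub
      (hasRep_insertComb hX 3 s 1 s.opp)).sub (hasRep_insertComb hX 3 s 2 s)).sub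
      (hasRep_insertComb hX 3 s 2 s.opp)).sub (hasRep_insertComb hX 3 s 1 s)) fun f c => ?_
  rcases Side.eq_or_eq_opp s c with rfl | rfl <;> simp [delta3, asc_zero, desc_zero]

theorem lie_OP2_lie_OP2_G (s : Side) : EqOnTrees ⁅OP2 s, ⁅OP2 s, G⁆⁆ ⁅OP2 s, G⁆ := by
  intro X hX
  have hX := hX.forest
  have h2 := (hasRep_G hX).lie_OP2 hX s
  refine (h2.lie_OP2 hX s).ext h2 fun f c => ?_
  rcases asc_cases hX s f with ⟨h1, h2⟩ | ⟨h1, h2⟩ | ⟨h1, h2⟩ <;>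
  rcases desc_cases hX s f with ⟨d1, d2⟩ | ⟨d1, d2⟩ | ⟨d1, d2⟩ <;>
  rcases Side.eq_or_eq_opp s c with rfl | rfl <;>
  simp [delta2, h1, d1]

theorem hasRep_RP3' {X : TGraph} (hX : IsPRBF X) (s : Side) : HasRep X (RP3' s) fun f c =>
    if c = s then (asc X s 1 f : ℝ) * desc X s 2 f else 0 :=
  hasRep_insertComb hX 3 s 1 s

theorem lie_OP2_lie_OP3_G (s : Side) :
    EqOnTrees ⁅OP2 s, ⁅OP3 s, G⁆⁆ (⁅OP3 s, G⁆ + RP3' s) := by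
  intro X hX
  have hX := hX.forest
  have h3 := (hasRep_G hX).lie_OP3 hX s
  refine (h3.lie_OP2 hX s).ext (h3.add (hasRep_RP3' hX s)) fun f c => ?_
  rcases asc_cases hX s f with ⟨h1, h2⟩ | ⟨h1, h2⟩ | ⟨h1, h2⟩ <;>
  rcases desc_cases hX s f with ⟨d1, d2⟩ | ⟨d1, d2⟩ | ⟨d1, d2⟩ <;>
  rcases Side.eq_or_eq_opp s c with rfl | rfl <;>
  simp [delta2, delta3, h1, h2, d1, d2]

theorem lie_OP3_lie_OP3_G (s : Side) :
    EqOnTrees ⁅OP3 s, ⁅OP3 s, G⁆⁆ (⁅OP3 s, G⁆ + (2 : ℝ) • RP3' s) := by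
  intro X hX
  have hX := hX.forest
  have h3 := (hasRep_G hX).lie_OP3 hX s
  refine (h3.lie_OP3 hX s).ext (h3.add ((hasRep_RP3' hX s).smul 2)) fun f c => ?_
  rcases asc_cases hX s f with ⟨h1, h2⟩ | ⟨h1, h2⟩ | ⟨h1, h2⟩ <;>
  rcases desc_cases hX s f with ⟨d1, d2⟩ | ⟨d1, d2⟩ | ⟨d1, d2⟩ <;>
  rcases Side.eq_or_eq_opp s c with rfl | rfl <;>
  norm_num [delta3, h1, h2, d1, d2]

theorem lie_OP2_RP3' (s : Side) : EqOnTrees ⁅OP2 s, RP3' s⁆ 0 := by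
  intro X hX
  have hX := hX.forest
  refine ((hasRep_RP3' hX s).lie_OP2 hX s).ext (.zero X) fun f c => ?_
  rcases desc_cases hX s f with ⟨d1, d2⟩ | ⟨d1, d2⟩ | ⟨d1, d2⟩ <;>
  rcases Side.eq_or_eq_opp s c with rfl | rfl <;>
  simp [delta2, d1, d2]

theorem lie_OP3_RP3' (s : Side) : EqOnTrees ⁅OP3 s, RP3' s⁆ (-RP3' s) := by
  intro X hX
  have hX := hX.forest
  refine ((hasRep_RP3' hX s).lie_OP3 hX s).ext (hasRep_RP3' hX s).neg fun f c => ?_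
  rcases asc_cases hX s f with ⟨h1, h2⟩ | ⟨h1, h2⟩ | ⟨h1, h2⟩ <;>
  rcases desc_cases hX s f with ⟨d1, d2⟩ | ⟨d1, d2⟩ | ⟨d1, d2⟩ <;>
  rcases Side.eq_or_eq_opp s c with rfl | rfl <;>
  simp [delta3, h1, h2, d1, d2]

theorem bra_obs_ket (s : Side) (i : Fin 4) (X : TGraph) : bra (obs s i (ket X)) = counts s X i := by
  rw [obs_ket, map_smul, bra_ket, smul_eq_mul, mul_one]

theorem bra_G_ket {X : TGraph} (hX : IsPRBF X) (s : Side) :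
    bra (G (ket X)) = 2 * counts s X 0 := by
  rw [(hasRep_G hX).bra]
  have h := sum_delta hX s fun _ _ => (1 : ℝ)
  rw [h]
  simp only [zsmul_eq_mul]
  push_cast
  ring

theorem bra_G : BraEqOnTrees G ((2 : ℝ) • OE) := by
  intro X hX
  rw [bra_G_ket hX.forest .L, LinearMap.smul_apply, map_smul, smul_eq_mul]
  exact congrArg _ (bra_obs_ket .L 0 X).symm

theorem bra_lie_OP2_G (s : Side) :
    BraEqOnTrees ⁅OP2 s, G⁆ ((3 : ℝ) • OP1 - (2 : ℝ) • OP2 s) := by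
  intro X hX
  have h1 : bra (OP1 (ket X)) = _ := bra_obs_ket s 1 X
  have h2 : bra (OP2 s (ket X)) = _ := bra_obs_ket s 2 X
  rw [((hasRep_G hX.forest).lie_OP2 hX.forest s).bra]
  simp only [mul_one, LinearMap.sub_apply, LinearMap.smul_apply, map_sub, map_smul, h1, h2]
  rw [sum_delta hX.forest s fun a _ => (a : ℝ)]
  simp only [zsmul_eq_mul, smul_eq_mul]
  push_cast
  ring

theorem bra_lie_OP3_G (s : Side) :
    BraEqOnTrees ⁅OP3 s, G⁆ ((4 : ℝ) • OP2 s - (4 : ℝ) • OP3 s) := by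
  intro X hX
  have h2 : bra (OP2 s (ket X)) = _ := bra_obs_ket s 2 X
  have h3 : bra (OP3 s (ket X)) = _ := bra_obs_ket s 3 X
  rw [((hasRep_G hX.forest).lie_OP3 hX.forest s).bra]
  simp only [mul_one, LinearMap.sub_apply, LinearMap.smul_apply, map_sub, map_smul, h2, h3]
  rw [sum_delta hX.forest s fun _ b => (b : ℝ)]
  simp only [zsmul_eq_mul, smul_eq_mul]
  push_cast
  ring

theorem bra_RP3' (s : Side) : BraEqOnTrees (RP3' s) (OP3 s) := by
  intro X hX
  have h3 : bra (OP3 s (ket X)) = _ := bra_obs_ket s 3 X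
  rw [(hasRep_RP3' hX.forest s).bra, h3, counts_three]
  have h := combCount_eq_sum hX.forest 3 s 1
  rw [← Int.cast_natCast (combCount 3 s X), h]
  simp

/-! ### Polynomial jump-closure -/

theorem dotObs_ket (s : Side) (ω : Fin 4 → ℝ) (X : TGraph) :
    dotObs s ω (ket X) = (∑ i, ω i * counts s X i) • ket X := by
  simp only [dotObs, LinearMap.sum_apply, LinearMap.smul_apply, obs_ket, Finset.sum_smul, smul_smul]

theorem hasRep_ad_iterate {X : TGraph} (hX : IsPRBF X) (s : Side) (ω : Fin 4 → ℝ) (q : ℕ) :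
    HasRep X ((fun B => ⁅dotObs s ω, B⁆)^[q] G)
      fun f c => (∑ i, ω i * delta X s f c i) ^ q := by
  induction q with
  | zero => simpa using hasRep_G hX
  | succ q ih =>
    rw [Function.iterate_succ_apply']
    refine (ih.lie _ (dotObs_ket s ω)).congr fun f c => ?_
    rw [pow_succ', ← Finset.sum_sub_distrib]
    congr 1
    refine Finset.sum_congr rfl fun i _ => ?_
    have h : (counts s (insertLeaf X f c) i : ℝ) = counts s X i + delta X s f c i := by
      exact_mod_cast counts_insertLeaf hX s f c i
    rw [h]
    ring

theorem obsPow_single (s : Side) (i : Fin 4) : obsPow s (Pi.single i 1) = obs s i := by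
  fin_cases i <;> simp [obsPow, List.ofFn_succ]

/-- A linear combination of the observables is a polynomial in them. -/
theorem sum_smul_obsPow (s : Side) (a : Fin 4 → ℝ) :
    ∑ k ∈ Finset.Iic (1 : Fin 4 → ℕ), (∑ i, if k = Pi.single i 1 then a i else 0) • obsPow s k
      = ∑ i, a i • obs s i := by
  simp only [Finset.sum_smul, ite_smul, zero_smul]
  rw [Finset.sum_comm]
  refine Finset.sum_congr rfl fun i _ => ?_
  rw [Finset.sum_ite_eq', if_pos, obsPow_single]
  rw [Finset.mem_Iic]
  intro j
  by_cases h : j = i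
  · subst h; simp
  · simp [h]

theorem polynomiallyJumpClosed (s : Side) : PolynomiallyJumpClosed s := by
  intro q
  -- The coefficients of the linear form are read off from the distribution of the increments.
  let v : (Fin 4 → ℝ) → ℝ → ℝ → ℝ := fun ω a b => (ω 0 * 2 + ω 1 + ω 2 * a + ω 3 * b) ^ q
  let γ : (Fin 4 → ℝ) → Fin 4 → ℝ := fun ω => ![2 * v ω 0 0, -3 * v ω 0 0 + 3 * v ω 1 0,
    2 * v ω 0 0 - 6 * v ω 1 0 + 4 * v ω 1 1, - v ω 0 0 + 3 * v ω 1 0 - 3 * v ω 1 1 + v ω 0 (-1)]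
  refine ⟨1, fun ω k => ∑ i, if k = Pi.single i 1 then γ ω i else 0, fun ω X hX => ?_⟩
  rw [sum_smul_obsPow, (hasRep_ad_iterate hX.forest s ω q).bra]
  simp only [LinearMap.sum_apply, LinearMap.smul_apply, map_sum, map_smul, bra_obs_ket]
  have h := sum_delta hX.forest s fun a b => v ω a b
  have h' : ∀ f c, (∑ i, ω i * (delta X s f c i : ℝ)) ^ q
      = v ω (delta2 X s f c) (delta3 X s f c) := by
    intro f c
    simp [Fin.sum_univ_four, delta, v]
  simp only [h', h]
  simp only [Fin.sum_univ_four, zsmul_eq_mul, smul_eq_mul, γ]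
  simp
  ring

/-! ### The span of the trees -/

/-- The span of the planar rooted binary trees. -/
def treeSpan : Submodule ℝ Chat := Submodule.span ℝ {v | ∃ X, IsPRBT X ∧ ket X = v}

theorem ket_mem_treeSpan {X : TGraph} (hX : IsPRBT X) : ket X ∈ treeSpan :=
  Submodule.subset_span ⟨X, hX, rfl⟩

theorem HasRep.mem_treeSpan {X : TGraph} (hX : IsPRBT X) {B : Op} {b : X.E → Side → ℝ}
    (hB : HasRep X B b) : B (ket X) ∈ treeSpan := by
  rw [hB]
  exact Submodule.sum_mem _ fun f _ => Submodule.sum_mem _ fun c _ =>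
    Submodule.smul_mem _ _ (ket_mem_treeSpan (hX.insertLeaf f c))

/-- Linear maps that agree on all trees agree on the span of the trees. -/
theorem eqOn_treeSpan {M : Type*} [AddCommGroup M] [Module ℝ M] {A B : Chat →ₗ[ℝ] M}
    (h : ∀ X, IsPRBT X → A (ket X) = B (ket X)) {v : Chat} (hv : v ∈ treeSpan) : A v = B v := by
  refine LinearMap.eqOn_span (s := {v | ∃ X, IsPRBT X ∧ ket X = v}) ?_ hv
  rintro _ ⟨X, hX, rfl⟩
  exact h X hX

theorem map_mem_treeSpan {B : Op} (h : ∀ X, IsPRBT X → B (ket X) ∈ treeSpan) {v : Chat}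
    (hv : v ∈ treeSpan) : B v ∈ treeSpan := by
  have : treeSpan ≤ treeSpan.comap B := by
    refine Submodule.span_le.2 ?_
    rintro _ ⟨X, hX, rfl⟩
    exact h X hX
  exact this hv

theorem pow_rootTree_mem_treeSpan {B : Op} (h : ∀ X, IsPRBT X → B (ket X) ∈ treeSpan) (n : ℕ) :
    (B ^ n) (ket rootTree) ∈ treeSpan := by
  induction n with
  | zero => exact ket_mem_treeSpan isPRBT_rootTree
  | succ n ih =>
    rw [pow_succ', Module.End.mul_apply]
    exact map_mem_treeSpan h ih

theorem G_mem_treeSpan (X : TGraph) (hX : IsPRBT X) : G (ket X) ∈ treeSpan :=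
  (hasRep_G hX.forest).mem_treeSpan hX

/-- Linear induction over the vectors `|X⟩`. -/
theorem chat_induction {p : Chat → Prop} (h0 : p 0) (hadd : ∀ v w, p v → p w → p (v + w))
    (hket : ∀ (r : ℝ) X, p (r • ket X)) (v : Chat) : p v := by
  induction v using Finsupp.induction_linear with
  | zero => exact h0
  | add v w hv hw => exact hadd v w hv hw
  | single c r =>
    obtain ⟨X, rfl⟩ := Quotient.exists_rep (s := isoSetoid) c
    have : Finsupp.single (Quotient.mk isoSetoid X : IsoClass) r = r • ket X :=
      (Finsupp.smul_single_one _ r).symm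
    exact this ▸ hket r X

/-! ### The moment generating function -/

/-- The linear map `⟨|e^{ω · Ô}`, with `⟨|e^{ω · Ô}|X⟩ = e^{ω · N(X)}`. -/
def braExp (s : Side) (ω : Fin 4 → ℝ) : Chat →ₗ[ℝ] ℝ :=
  Finsupp.linearCombination ℝ fun c : IsoClass =>
    Real.exp (∑ i, ω i * counts s (Quotient.out c) i)

theorem braExp_ket (s : Side) (ω : Fin 4 → ℝ) (X : TGraph) :
    braExp s ω (ket X) = Real.exp (∑ i, ω i * counts s X i) := by
  have h : Iso (Quotient.out (Quotient.mk isoSetoid X)) X :=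
    Quotient.exact (s := isoSetoid) (Quotient.out_eq _)
  rw [← counts_eq_of_iso s h]
  exact linearCombination_ket _ X

theorem hasSum_braExpTerm (s : Side) (ω : Fin 4 → ℝ) (v : Chat) :
    HasSum (braExpTerm (dotObs s ω) v) (braExp s ω v) := by
  induction v using chat_induction with
  | h0 =>
    have h : braExpTerm (dotObs s ω) 0 = fun _ => 0 := funext fun k => by simp [braExpTerm]
    rw [h, map_zero]
    exact hasSum_zero
  | hadd v w hv hw =>
    rw [map_add]
    convert! hv.add hw using 1
    funext k
    simp only [braExpTerm, map_add, mul_add]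
  | hket r X =>
    have hpow : ∀ k : ℕ, (dotObs s ω ^ k) (ket X) = (∑ i, ω i * counts s X i) ^ k • ket X := by
      intro k
      induction k with
      | zero => simp
      | succ k ih =>
        rw [pow_succ', Module.End.mul_apply, ih, map_smul, dotObs_ket, smul_smul, pow_succ]
    have h := (NormedSpace.expSeries_div_hasSum_exp (∑ i, ω i * (counts s X i : ℝ))).mul_left r
    rw [← Real.exp_eq_exp_ℝ] at h
    rw [map_smul, braExp_ket, smul_eq_mul]
    convert! h using 1
    funext k
    rw [braExpTerm, map_smul, hpow, map_smul, map_smul, bra_ket]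
    simp only [smul_eq_mul, mul_one]
    ring

theorem coeff_egf (s : Side) (ω : Fin 4 → ℝ) (n : ℕ) :
    PowerSeries.coeff n (egf s ω) = (n ! : ℝ)⁻¹ * braExp s ω ((G ^ n) (ket rootTree)) := by
  rw [egf, PowerSeries.coeff_mk, (hasSum_braExpTerm s ω _).tsum_eq]

theorem contDiff_braExp (s : Side) (v : Chat) :
    ContDiff ℝ (⊤ : ℕ∞) fun ω => braExp s ω v := by
  induction v using chat_induction with
  | h0 => simpa using contDiff_const
  | hadd v w hv hw => simpa using hv.add hw
  | hket r X =>
    simp only [map_smul, braExp_ket]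
    fun_prop

/-- Differentiation of `⟨|e^{ω · Ô} v` in the direction `i` applies the observable `Ôᵢ` to `v`. -/
theorem fderiv_braExp (s : Side) (i : Fin 4) (v : Chat) (ω : Fin 4 → ℝ) :
    fderiv ℝ (fun ω => braExp s ω v) ω (Pi.single i 1) = braExp s ω (obs s i v) := by
  induction v using chat_induction with
  | h0 => simp
  | hadd v w hv hw =>
    have h (v : Chat) : DifferentiableAt ℝ (fun ω => braExp s ω v) ω :=
      (contDiff_braExp s v).contDiffAt.differentiableAt (by simp)
    simp only [map_add]
    rw [fderiv_fun_add (h v) (h w), add_apply, hv, hw]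
  | hket r X =>
    have h : HasFDerivAt (fun w : Fin 4 → ℝ => ∑ j, w j * (counts s X j : ℝ))
        (∑ j, (counts s X j : ℝ) • (ContinuousLinearMap.proj j : (Fin 4 → ℝ) →L[ℝ] ℝ)) ω :=
      HasFDerivAt.fun_sum fun j _ => (hasFDerivAt_apply j ω).mul_const _
    simp only [map_smul, braExp_ket, obs_ket, smul_eq_mul]
    rw [(h.exp.const_mul r).fderiv]
    simp [Pi.single_apply, mul_comm]

theorem coeff_dEgf (s : Side) (i : Fin 4) (ω : Fin 4 → ℝ) (n : ℕ) :
    PowerSeries.coeff n (dEgf s i ω)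
      = (n ! : ℝ)⁻¹ * braExp s ω (obs s i ((G ^ n) (ket rootTree))) := by
  rw [dEgf, PowerSeries.coeff_mk]
  simp only [coeff_egf]
  rw [fderiv_const_mul ((contDiff_braExp s _).contDiffAt.differentiableAt (by simp)),
    smul_apply, fderiv_braExp, smul_eq_mul]

/-- The evolution equation before it is evaluated at a power of `G`. -/
theorem braExp_G (s : Side) (ω : Fin 4 → ℝ) {v : Chat} (hv : v ∈ treeSpan) :
    braExp s ω (G v) = Real.exp (2 * ω 0 + ω 1) *
      (2 * braExp s ω (obs s 0 v) + 3 * (Real.exp (ω 2) - 1) * braExp s ω (obs s 1 v)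
        + (4 * Real.exp (ω 2 + ω 3) - 6 * Real.exp (ω 2) + 2) * braExp s ω (obs s 2 v)
        + (3 * Real.exp (ω 2) + Real.exp (-ω 3) - 3 * Real.exp (ω 2 + ω 3) - 1)
          * braExp s ω (obs s 3 v)) := by
  let b : Fin 4 → Chat →ₗ[ℝ] ℝ := fun i => braExp s ω ∘ₗ obs s i
  refine eqOn_treeSpan (A := braExp s ω ∘ₗ G) (B := Real.exp (2 * ω 0 + ω 1) •
      ((2 : ℝ) • b 0 + (3 * (Real.exp (ω 2) - 1)) • b 1
        + (4 * Real.exp (ω 2 + ω 3) - 6 * Real.exp (ω 2) + 2) • b 2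
        + (3 * Real.exp (ω 2) + Real.exp (-ω 3) - 3 * Real.exp (ω 2 + ω 3) - 1) • b 3))
      (fun X hX => ?_) hv
  have hb : ∀ i, b i (ket X) = counts s X i * Real.exp (∑ i, ω i * counts s X i) := by
    intro i
    simp only [b, LinearMap.comp_apply, obs_ket, map_smul, braExp_ket, smul_eq_mul]
  simp only [LinearMap.smul_apply, LinearMap.add_apply, LinearMap.comp_apply, hb, smul_eq_mul]
  let F : ℤ → ℤ → ℝ := fun x y => Real.exp (2 * ω 0 + ω 1)
    * Real.exp (∑ i, ω i * counts s X i) * Real.exp (ω 2 * x + ω 3 * y)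
  have hF : ∀ f c, braExp s ω (ket (insertLeaf X f c)) = F (delta2 X s f c) (delta3 X s f c) := by
    intro f c
    have h : ∀ i, (counts s (insertLeaf X f c) i : ℝ) = counts s X i + delta X s f c i := by
      intro i
      exact_mod_cast counts_insertLeaf hX.forest s f c i
    simp only [braExp_ket, h, F, ← Real.exp_add]
    congr 1
    simp only [Fin.sum_univ_four, delta, Matrix.cons_val]
    push_cast
    ring
  rw [hasRep_G hX.forest]
  simp only [map_sum, one_smul, hF, sum_delta hX.forest s F]
  simp only [F, zsmul_eq_mul]
  push_cast
  simp only [mul_zero, mul_one, mul_neg, zero_add, add_zero, Real.exp_zero]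
  ring

theorem derivative_egf (s : Side) (ω : Fin 4 → ℝ) :
    PowerSeries.derivative ℝ (egf s ω) = Real.exp (2 * ω 0 + ω 1) •
      ((2 : ℝ) • dEgf s 0 ω + (3 * (Real.exp (ω 2) - 1)) • dEgf s 1 ω
        + (4 * Real.exp (ω 2 + ω 3) - 6 * Real.exp (ω 2) + 2) • dEgf s 2 ω
        + (3 * Real.exp (ω 2) + Real.exp (-ω 3) - 3 * Real.exp (ω 2 + ω 3) - 1)
          • dEgf s 3 ω) := by
  ext n
  have hfac : ((n + 1)! : ℝ)⁻¹ * (n + 1) = (n ! : ℝ)⁻¹ := by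
    rw [Nat.factorial_succ]
    have : (n ! : ℝ) ≠ 0 := by positivity
    push_cast
    field_simp
  simp only [PowerSeries.coeff_derivative, PowerSeries.coeff_smul, map_add, coeff_dEgf, coeff_egf,
    smul_eq_mul]
  rw [pow_succ', Module.End.mul_apply, braExp_G s ω (pow_rootTree_mem_treeSpan G_mem_treeSpan n),
    ← hfac]
  ring

/-! ### Pattern count polynomials -/

theorem eval_braPow (s : Side) {x : Fin 4 → ℝ} (hx : ∀ i, 0 < x i) (v : Chat) :
    MvPolynomial.eval x (braPow s v) = braExp s (fun i => Real.log (x i)) v := by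
  induction v using chat_induction with
  | h0 => simp
  | hadd v w hv hw => rw [map_add, map_add, map_add, hv, hw]
  | hket r X =>
    rw [map_smul, MvPolynomial.smul_eval, map_smul, braExp_ket, braPow_ket,
      MvPolynomial.eval_monomial, Real.exp_sum, smul_eq_mul, one_mul,
      Finsupp.prod_fintype _ _ fun _ => pow_zero _]
    congr 1
    refine Finset.prod_congr rfl fun i _ => ?_
    rw [mul_comm, Real.exp_nat_mul, Real.exp_log (hx i)]

theorem egf_log (s : Side) {x : Fin 4 → ℝ} (hx : ∀ i, 0 < x i) :
    egf s (fun i => Real.log (x i)) = PowerSeries.map (MvPolynomial.eval x) (pgf s G) := by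
  ext n
  rw [coeff_egf, PowerSeries.coeff_map, pgf, PowerSeries.coeff_mk, MvPolynomial.smul_eval,
    eval_braPow s hx]

/-- An operator on polynomials that describes the action of `B` on the pattern counts of trees
generates the evolution of the generating function of `B`. -/
theorem derivative_pgf (s : Side) (B : Op) (A : Poly →ₗ[ℝ] Poly)
    (hB : ∀ X, IsPRBT X → B (ket X) ∈ treeSpan)
    (hA : ∀ X, IsPRBT X → braPow s (B (ket X)) = A (MvPolynomial.monomial (counts s X) 1)) :
    PowerSeries.derivative Poly (pgf s B)
      = PowerSeries.mk (fun n => A (PowerSeries.coeff n (pgf s B))) := by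
  ext1 n
  have hfac : ((n + 1)! : ℝ)⁻¹ * (n + 1) = (n ! : ℝ)⁻¹ := by
    rw [Nat.factorial_succ]
    have : (n ! : ℝ) ≠ 0 := by positivity
    push_cast
    field_simp
  have h : braPow s (B ((B ^ n) (ket rootTree))) = A (braPow s ((B ^ n) (ket rootTree))) :=
    eqOn_treeSpan (A := braPow s ∘ₗ B) (B := A ∘ₗ braPow s)
      (fun X hX => by simpa using hA X hX) (pow_rootTree_mem_treeSpan hB n)
  rw [PowerSeries.coeff_derivative, PowerSeries.coeff_mk, pgf, PowerSeries.coeff_mk,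
    PowerSeries.coeff_mk, map_smul, ← h, pow_succ', Module.End.mul_apply, ← hfac, mul_smul]
  rw [smul_mul_assoc]
  congr 1
  rw [MvPolynomial.smul_eq_C_mul, mul_comm]
  simp

theorem num_monomial (i : Fin 4) (N : Fin 4 →₀ ℕ) :
    num i (MvPolynomial.monomial N 1) = (N i : ℝ) • MvPolynomial.monomial N 1 := by
  rw [num, LinearMap.comp_apply, LinearMap.mulLeft_apply, Derivation.coeFn_coe,
    MvPolynomial.X_mul_pderiv_monomial, Nat.cast_smul_eq_nsmul]

theorem braPow_G {X : TGraph} (hX : IsPRBF X) (s : Side) :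
    braPow s (G (ket X)) = D (MvPolynomial.monomial (counts s X) 1) := by
  set N := counts s X with hN
  let e : ℤ → ℤ → Fin 4 →₀ ℕ := fun a b => Finsupp.equivFunOnFinite.symm
    ![N 0 + 2, N 1 + 1, (N 2 + a).toNat, (N 3 + b).toNat]
  let F : ℤ → ℤ → Poly := fun a b => MvPolynomial.monomial (e a b) 1
  have hF : ∀ f c, braPow s (ket (insertLeaf X f c)) = F (delta2 X s f c) (delta3 X s f c) := by
    intro f c
    rw [braPow_ket]
    refine congrArg (fun m => MvPolynomial.monomial m (1 : ℝ)) (Finsupp.ext fun i => ?_)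
    have h : (counts s (insertLeaf X f c) i : ℤ) = N i + delta X s f c i :=
      counts_insertLeaf hX s f c i
    fin_cases i <;> simp [delta, e] at h ⊢ <;> omega
  have h00 : F 0 0 = MvPolynomial.X 0 ^ 2 * MvPolynomial.X 1 * MvPolynomial.monomial N 1 := by
    simp only [F, MvPolynomial.X, MvPolynomial.monomial_pow, MvPolynomial.monomial_mul, one_pow,
      one_mul]
    refine congrArg (fun m => MvPolynomial.monomial m (1 : ℝ)) (Finsupp.ext fun i => ?_)
    fin_cases i <;> simp [e, add_comm]
  have h10 : F 1 0 = MvPolynomial.X 0 ^ 2 * MvPolynomial.X 1 *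
      (MvPolynomial.X 2 * MvPolynomial.monomial N 1) := by
    simp only [F, MvPolynomial.X, MvPolynomial.monomial_pow, MvPolynomial.monomial_mul, one_pow,
      one_mul]
    refine congrArg (fun m => MvPolynomial.monomial m (1 : ℝ)) (Finsupp.ext fun i => ?_)
    fin_cases i <;> simp [e, add_comm]
    omega
  have h11 : F 1 1 = MvPolynomial.X 0 ^ 2 * MvPolynomial.X 1 *
      (MvPolynomial.X 2 * MvPolynomial.X 3 * MvPolynomial.monomial N 1) := by
    simp only [F, MvPolynomial.X, MvPolynomial.monomial_pow, MvPolynomial.monomial_mul, one_pow,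
      one_mul]
    refine congrArg (fun m => MvPolynomial.monomial m (1 : ℝ)) (Finsupp.ext fun i => ?_)
    fin_cases i <;> simp [e, add_comm] <;> omega
  -- For `N 3 = 0` both sides vanish, which makes up for the truncation of the exponent `-1`.
  have h0m : (N 3 : ℝ) • F 0 (-1) = MvPolynomial.X 0 ^ 2 * MvPolynomial.X 1 *
      MvPolynomial.pderiv 3 (MvPolynomial.monomial N 1) := by
    rw [MvPolynomial.pderiv_monomial, MvPolynomial.smul_monomial]
    simp only [MvPolynomial.X, MvPolynomial.monomial_pow, MvPolynomial.monomial_mul, one_pow,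
      one_mul, smul_eq_mul, mul_one]
    refine congrArg (fun m => MvPolynomial.monomial m (N 3 : ℝ)) (Finsupp.ext fun i => ?_)
    fin_cases i <;> simp [e, add_comm]
    omega
  have hZ : ∀ (z : ℤ) (p : Poly), z • p = (z : ℝ) • p := fun z p =>
    (Int.cast_smul_eq_zsmul ℝ z p).symm
  rw [hasRep_G hX]
  simp only [map_sum, one_smul, hF, sum_delta hX s F, hZ, ← hN]
  simp only [Int.cast_natCast, h0m, h00, h10, h11]
  simp only [D, LinearMap.comp_apply, LinearMap.add_apply, LinearMap.sub_apply,
    LinearMap.smul_apply, LinearMap.mulLeft_apply, num_monomial, Derivation.coeFn_coe]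
  push_cast
  simp only [MvPolynomial.smul_eq_C_mul, map_add, map_sub, map_mul]
  ring

theorem eval_one_D (p : Poly) :
    MvPolynomial.eval 1 (D p) = MvPolynomial.eval 1 ((2 : ℝ) • num 0 p) := by
  simp only [D, num, LinearMap.comp_apply, LinearMap.add_apply, LinearMap.sub_apply,
    LinearMap.smul_apply, LinearMap.mulLeft_apply, Derivation.coeFn_coe, map_mul, map_add, map_sub,
    map_pow, MvPolynomial.smul_eval, MvPolynomial.eval_X, Pi.one_apply]
  ring

theorem counts_zero_pos {X : TGraph} (hX : IsPRBT X) (s : Side) : 0 < counts s X 0 := by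
  have h := combCount_eq_sum hX.forest 0 s 0
  simp only [Fin.val_zero, asc_zero, desc_zero, tsub_zero, mul_one, Finset.sum_const,
    Finset.card_univ, nsmul_eq_mul] at h
  rw [counts_zero hX.forest]
  have := hX.nonempty
  have : 0 < Fintype.card X.E := Fintype.card_pos
  omega

theorem dPoly_monomial {N : Fin 4 →₀ ℕ} (hN : 0 < N 0) :
    dPoly (MvPolynomial.monomial N 1) = (2 * (N 0 : ℝ))⁻¹ • D (MvPolynomial.monomial N 1) := by
  have h : invTwoNum (MvPolynomial.monomial N 1)
      = (2 * (N 0 : ℝ))⁻¹ • MvPolynomial.monomial N 1 := by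
    have h1 := (MvPolynomial.basisMonomials (Fin 4) ℝ).constr_basis ℝ (fun N =>
      if N 0 = 0 then MvPolynomial.monomial N 1
      else (MvPolynomial.monomial N (2 * (N 0 : ℝ))⁻¹ : Poly)) N
    rw [MvPolynomial.coe_basisMonomials] at h1
    rw [invTwoNum, h1, if_neg hN.ne', MvPolynomial.smul_monomial, smul_eq_mul, mul_one]
  rw [dPoly, LinearMap.comp_apply, h, map_smul]

theorem isDTMCGenerator_dPoly (s : Side) : IsDTMCGenerator (treeCounts s) dPoly := by
  rintro N ⟨X, hX, rfl⟩
  have hpos := counts_zero_pos hX s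
  have hpos' : (0 : ℝ) < counts s X 0 := by exact_mod_cast hpos
  have hcoeff : ∀ M, (dPoly (MvPolynomial.monomial (counts s X) 1)).coeff M
      = (2 * (counts s X 0 : ℝ))⁻¹ *
        ∑ f, ∑ c, if counts s (insertLeaf X f c) = M then (1 : ℝ) else 0 := by
    intro M
    rw [dPoly_monomial hpos, ← braPow_G hX.forest, hasRep_G hX.forest]
    simp [MvPolynomial.coeff_sum, MvPolynomial.coeff_monomial]
  refine ⟨fun M => ?_, fun M hM => ?_, ?_⟩
  · rw [hcoeff]
    exact mul_nonneg (by positivity) (Finset.sum_nonneg fun f _ => Finset.sum_nonneg fun c _ => by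
      split_ifs <;> norm_num)
  · by_contra hS
    refine hM ?_
    rw [hcoeff]
    refine mul_eq_zero_of_right _ (Finset.sum_eq_zero fun f _ => Finset.sum_eq_zero fun c _ => ?_)
    exact if_neg fun h => hS ⟨_, hX.insertLeaf f c, h⟩
  · have h1 : ∀ p : Poly, ∑ M ∈ p.support, p.coeff M = MvPolynomial.eval 1 p := by
      intro p
      simp [MvPolynomial.eval_eq]
    rw [h1, dPoly_monomial hpos, MvPolynomial.smul_eval, eval_one_D, num_monomial]
    simp only [MvPolynomial.smul_eval, MvPolynomial.eval_monomial, Pi.one_apply, one_pow,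
      Finsupp.prod_fun_one, mul_one]
    field_simp

/-! ### The embedded chain -/

theorem OG_ket {X : TGraph} (hX : IsPRBF X) (s : Side) :
    OG (ket X) = (2 * (counts s X 0 : ℝ)) • ket X := by
  have h : ∀ (c : Side) (T : EdgeType),
      rho (idRule (comb 0 T .L) (insertRule (comb 0 T .L) (.inl 0) c).cond) (ket X)
        = (Nat.card {m : Hom (comb 0 T .L) X // m.IsMono} : ℝ) • ket X := by
    intro c T
    refine (rho_idRule_ket _ _ (fun _ hθ _ h => IsPRBF.of_isIso hθ h) X).trans ?_
    congr 2
    exact Nat.card_congr (Equiv.subtypeEquivRight fun m => ⟨fun h => h.1, fun h => ⟨h, hX⟩⟩)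
  have h0 : (counts s X 0 : ℝ) = ∑ T, (Nat.card {m : Hom (comb 0 T .L) X // m.IsMono} : ℝ) := by
    rw [← Nat.cast_sum]
    rfl
  simp only [OG, LinearMap.sum_apply, h, ← Finset.sum_smul, ← h0]
  rw [sum_side .L, two_mul]

theorem dOp_ket {X : TGraph} (hX : IsPRBT X) (s : Side) :
    dOp (ket X) = (2 * (counts s X 0 : ℝ))⁻¹ • G (ket X) := by
  have hpos : (0 : ℝ) < counts s X 0 := by exact_mod_cast counts_zero_pos hX s
  have hG : G (ket X) ≠ 0 := by
    intro h
    have h1 := bra_G_ket hX.forest s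
    rw [h, map_zero] at h1
    linarith
  have h : invOG (ket X) = (bra (OG (ket X)))⁻¹ • ket X := by
    refine (linearCombination_ket _ X).trans ((if_neg hG).trans ?_)
    exact (Finsupp.smul_single_one _ _).symm
  rw [dOp, Module.End.mul_apply, h, OG_ket hX.forest s, map_smul, map_smul, bra_ket, smul_eq_mul,
    mul_one]

theorem hasRep_dOp {X : TGraph} (hX : IsPRBT X) (s : Side) :
    HasRep X dOp fun _ _ => (2 * (counts s X 0 : ℝ))⁻¹ * 1 := by
  rw [HasRep, dOp_ket hX s]
  exact (hasRep_G hX.forest).smul _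

theorem isTreeDistribution_dOp {X : TGraph} (hX : IsPRBT X) : IsTreeDistribution (dOp (ket X)) := by
  have hpos : (0 : ℝ) < counts .L X 0 := by exact_mod_cast counts_zero_pos hX .L
  have hket : ∀ Y (c : IsoClass), ket Y c = if Quotient.mk isoSetoid Y = c then 1 else 0 :=
    fun Y c => Finsupp.single_apply
  have hval : ∀ c, dOp (ket X) c = ∑ f, ∑ d, (2 * (counts .L X 0 : ℝ))⁻¹ *
      if Quotient.mk isoSetoid (insertLeaf X f d) = c then 1 else 0 := by
    intro c
    rw [hasRep_dOp hX .L]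
    simp [Finsupp.finsetSum_apply, hket]
  refine ⟨fun c => ?_, fun c hc => ?_, ?_⟩
  · rw [hval]
    exact Finset.sum_nonneg fun f _ => Finset.sum_nonneg fun d _ =>
      mul_nonneg (by positivity) (by split_ifs <;> norm_num)
  · by_contra h
    refine hc ?_
    rw [hval]
    refine Finset.sum_eq_zero fun f _ => Finset.sum_eq_zero fun d _ => ?_
    rw [if_neg fun h' => h ⟨_, hX.insertLeaf f d, h'⟩, mul_zero]
  · rw [dOp_ket hX .L, map_smul, bra_G_ket hX.forest .L, smul_eq_mul]
    field_simp

theorem braPow_dOp {X : TGraph} (hX : IsPRBT X) (s : Side) :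
    braPow s (dOp (ket X)) = dPoly (MvPolynomial.monomial (counts s X) 1) := by
  rw [dOp_ket hX s, map_smul, braPow_G hX.forest, dPoly_monomial (counts_zero_pos hX s)]

end PRBT

end

theorem mainTheorem2 (s : Side) :
    -- the observables are diagonal and count patterns
    (∀ (i : Fin 4) (X : TGraph), obs s i (ket X) = (counts s X i : ℝ) • ket X) ∧
    -- commutator identities
    (EqOnTrees ⁅OE, G⁆ ((2 : ℝ) • G) ∧ BraEqOnTrees G ((2 : ℝ) • OE) ∧
      EqOnTrees ⁅OP1, G⁆ G ∧
      EqOnTrees ⁅OP2 s, G⁆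
        (insertComb 1 s 0 s.opp + insertComb 1 s 1 s + insertComb 1 s 1 s.opp
          - insertComb 2 s 1 s - insertComb 2 s 1 s.opp) ∧
      EqOnTrees ⁅OP3 s, G⁆
        (insertComb 2 s 0 s.opp + insertComb 2 s 1 s.opp + insertComb 2 s 2 s
          + insertComb 2 s 2 s.opp
          - insertComb 3 s 1 s.opp - insertComb 3 s 2 s - insertComb 3 s 2 s.opp - RP3' s) ∧
      EqOnTrees ⁅OP2 s, ⁅OP2 s, G⁆⁆ ⁅OP2 s, G⁆ ∧
      EqOnTrees ⁅OP2 s, ⁅OP3 s, G⁆⁆ (⁅OP3 s, G⁆ + RP3' s) ∧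
      EqOnTrees ⁅OP3 s, ⁅OP3 s, G⁆⁆ (⁅OP3 s, G⁆ + (2 : ℝ) • RP3' s) ∧
      EqOnTrees ⁅OP2 s, RP3' s⁆ 0 ∧
      EqOnTrees ⁅OP3 s, RP3' s⁆ (-RP3' s) ∧
      BraEqOnTrees ⁅OP2 s, G⁆ ((3 : ℝ) • OP1 - (2 : ℝ) • OP2 s) ∧
      BraEqOnTrees ⁅OP3 s, G⁆ ((4 : ℝ) • OP2 s - (4 : ℝ) • OP3 s) ∧
      BraEqOnTrees (RP3' s) (OP3 s)) ∧
    -- polynomial jump-closure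
    PolynomiallyJumpClosed s ∧
    -- the moment generating function is well defined and satisfies the evolution equation
    (∀ ω n, Summable (braExpTerm (dotObs s ω) ((G ^ n) (ket rootTree)))) ∧
    (∀ n, ContDiff ℝ (⊤ : ℕ∞) fun ω : Fin 4 → ℝ => PowerSeries.coeff n (egf s ω)) ∧
    (∀ ω : Fin 4 → ℝ, ∀ ε γ μ ν : ℝ, ω = ![ε, γ, μ, ν] →
      PowerSeries.derivative ℝ (egf s ω) =
        Real.exp (2 * ε + γ) •
          ((2 : ℝ) • dEgf s 0 ω + (3 * (Real.exp μ - 1)) • dEgf s 1 ω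
            + (4 * Real.exp (μ + ν) - 6 * Real.exp μ + 2) • dEgf s 2 ω
            + (3 * Real.exp μ + Real.exp (-ν) - 3 * Real.exp (μ + ν) - 1) • dEgf s 3 ω)) ∧
    -- the evolution equation in the variables `x_i = exp ω_i`
    (∀ (x : Fin 4 → ℝ), (∀ i, 0 < x i) →
      egf s (fun i => Real.log (x i)) = PowerSeries.map (MvPolynomial.eval x) (pgf s G)) ∧
    PowerSeries.derivative Poly (pgf s G)
      = PowerSeries.mk (fun n => D (PowerSeries.coeff n (pgf s G))) ∧
    -- the coefficients of `D` sum to `2 n_ε`, and the normalised operator generates a Markov chain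
    -- on the pattern counts
    (∀ p : Poly, MvPolynomial.eval 1 (D p) = MvPolynomial.eval 1 ((2 : ℝ) • num 0 p)) ∧
    (∀ N ∈ treeCounts s, 0 < N 0) ∧
    IsDTMCGenerator (treeCounts s) dPoly ∧
    -- it is the chain of the pattern counts of the embedded Markov chain of `G`
    (∀ X, IsPRBT X → IsTreeDistribution (dOp (ket X)) ∧
      braPow s (dOp (ket X)) = dPoly (MvPolynomial.monomial (counts s X) 1)) ∧
    PowerSeries.derivative Poly (pgf s dOp)
      = PowerSeries.mk (fun n => dPoly (PowerSeries.coeff n (pgf s dOp))) := by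
  refine ⟨obs_ket s, ⟨lie_OE_G, bra_G, lie_OP1_G, lie_OP2_G s, lie_OP3_G s, lie_OP2_lie_OP2_G s,
    lie_OP2_lie_OP3_G s, lie_OP3_lie_OP3_G s, lie_OP2_RP3' s, lie_OP3_RP3' s, bra_lie_OP2_G s,
    bra_lie_OP3_G s, bra_RP3' s⟩, polynomiallyJumpClosed s,
    fun ω n => (hasSum_braExpTerm s ω _).summable, fun n => ?_, ?_, fun x hx => egf_log s hx,
    derivative_pgf s G D G_mem_treeSpan fun X hX => braPow_G hX.forest s, eval_one_D, ?_,
    isDTMCGenerator_dPoly s, fun X hX => ⟨isTreeDistribution_dOp hX, braPow_dOp hX s⟩,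
    derivative_pgf s dOp dPoly (fun X hX => (hasRep_dOp hX s).mem_treeSpan hX)
      fun X hX => braPow_dOp hX s⟩
  · simp only [coeff_egf]
    exact contDiff_const.mul (contDiff_braExp s _)
  · rintro _ ε γ μ ν rfl
    exact derivative_egf s ![ε, γ, μ, ν]
  · rintro N ⟨X, hX, rfl⟩
    exact counts_zero_pos hX s
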